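/- **Theorem (C-NOT counts for encoding a low-rank matrix).** A circuit on $n$ qubits is a finite sequence of C-NOT gates (between arbitrary pairs of distinct qubits) and arbitrary single-qubit gates in $\mathrm{U}(2)$; it implements the product of the corresponding $2^n\times 2^n$ unitary matrices. For $\alpha>0$, an $n$-qubit unitary $U$ is an $(\alpha,1)$-block-encoding of a matrix $A\in\mathbb{C}^{2^{n-1}\times 2^{n-1}}$ if $$A=\alpha\,(\langle 0|\otimes I_{2^{n-1}})\,U\,(|0\rangle\otimes I_{2^{n-1}}),$$ that is, if $A/\alpha$ is the upper left $2^{n-1}\times 2^{n-1}$ block of $U$. Let $\|A\|_2$ denote the spectral norm. There is an absolute constant $C>0$ such that for every $n\ge 1$, every $K$ with $1\le K\le 2^{n-1}-1$, and every matrix $A\in\mathbb{C}^{2^{n-1}\times 2^{n-1}}$ of rank $K$, there is a circuit on $n$ qubits (hence with a single ancilla qubit) that implements a $(\|A\|_2,1)$-block-encoding of $A$ and contains at most $$\Bigl(K+\frac{11}{12}\Bigr)2^n + C\,K\,n^2$$ C-NOT gates. -/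

import Mathlib

namespace QuantumCircuit

/-- Labels of the computational basis of a register of `n` qubits: bit strings of length `n`. -/
abbrev Bits (n : ℕ) : Type := Fin n → Fin 2

/-- The binary expansion, most significant bit first, so that `binary n k` is the bit string of the
basis vector `|k⟩` of `n` qubits. -/
def binary (n : ℕ) : Fin (2 ^ n) ≃ Bits n :=
  finFunctionFinEquiv.symm.trans (Equiv.arrowCongr Fin.revPerm (Equiv.refl (Fin 2)))

/-- An elementary gate on `n` qubits: an arbitrary single-qubit unitary `u ∈ U(2)` on qubit `q`,
or a C-NOT gate with control `c` and target `t`. -/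
inductive Gate (n : ℕ) : Type
  | single (q : Fin n) (u : Matrix.unitaryGroup (Fin 2) ℂ) : Gate n
  | cnot (c t : Fin n) (hct : c ≠ t) : Gate n

/-- The `2 ^ n × 2 ^ n` matrix of a gate. A single-qubit gate acts as `u` on qubit `q` and as the
identity on all other qubits; a C-NOT maps `|y⟩` to `|y'⟩`, where `y'` is `y` with the target bit
replaced by its sum modulo 2 with the control bit. -/
def Gate.toMatrix {n : ℕ} : Gate n → Matrix (Bits n) (Bits n) ℂ
  | .single q u => Matrix.of fun x y =>
      if ∀ p, p ≠ q → x p = y p then (u : Matrix (Fin 2) (Fin 2) ℂ) (x q) (y q) else 0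
  | .cnot c t _ => Matrix.of fun x y =>
      if x = Function.update y t (y t + y c) then 1 else 0

/-- A circuit on `n` qubits: a finite sequence of elementary gates, the first one applied first. -/
abbrev Circuit (n : ℕ) : Type := List (Gate n)

/-- The matrix implemented by a circuit. -/
def Circuit.toMatrix {n : ℕ} : Circuit n → Matrix (Bits n) (Bits n) ℂ
  | [] => 1
  | g :: gs => Circuit.toMatrix gs * g.toMatrix

/-- The number of C-NOT gates of a circuit. -/
def Circuit.cnotCount {n : ℕ} : Circuit n → ℕ
  | [] => 0
  | .single _ _ :: gs => Circuit.cnotCount gs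
  | .cnot _ _ _ :: gs => Circuit.cnotCount gs + 1

/-- The spectral norm `‖A‖₂` of a square complex matrix: its operator norm with respect to the
Euclidean norm. -/
noncomputable def specNorm {ι : Type*} [Fintype ι] [DecidableEq ι] (A : Matrix ι ι ℂ) : ℝ :=
  ‖Matrix.toEuclideanCLM (𝕜 := ℂ) A‖

/-- `(⟨0|^{⊗ a} ⊗ I) U (|0⟩^{⊗ a} ⊗ I)`, where the `a` ancilla qubits precede the `m` system
qubits: the block of `U` whose rows and columns are the basis vectors `|0 ⋯ 0⟩ ⊗ |i⟩`. -/
def ancillaBlock (a m : ℕ) (U : Matrix (Bits (a + m)) (Bits (a + m)) ℂ) :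
    Matrix (Fin (2 ^ m)) (Fin (2 ^ m)) ℂ :=
  Matrix.of fun i j =>
    U (Fin.append (0 : Bits a) (binary m i)) (Fin.append (0 : Bits a) (binary m j))

/-- `U` is an `(α, a, ε)`-block-encoding of the `m`-qubit operator `A`. -/
def IsBlockEncodingUpTo {m : ℕ} (α : ℝ) (a : ℕ) (ε : ℝ)
    (U : Matrix (Bits (a + m)) (Bits (a + m)) ℂ)
    (A : Matrix (Fin (2 ^ m)) (Fin (2 ^ m)) ℂ) : Prop :=
  0 < α ∧ U ∈ Matrix.unitaryGroup (Bits (a + m)) ℂ ∧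
    specNorm (A - (α : ℂ) • ancillaBlock a m U) ≤ ε

/-- `U` is an (exact) `(α, a)`-block-encoding of the `m`-qubit operator `A`. -/
def IsBlockEncoding {m : ℕ} (α : ℝ) (a : ℕ)
    (U : Matrix (Bits (a + m)) (Bits (a + m)) ℂ)
    (A : Matrix (Fin (2 ^ m)) (Fin (2 ^ m)) ℂ) : Prop :=
  IsBlockEncodingUpTo α a 0 U A

end QuantumCircuit

/-!
Write `n = m + 1`, with one ancilla qubit `a` and `m` system qubits, and let
`A = ∑ᵢ σᵢ wᵢ vᵢ*` be a singular value decomposition with `K` terms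
(`exists_singular_value_decomposition`). Suppose that circuits `V` and `W` map the vectors
`|0⟩ ⊗ vᵢ` and `|0⟩ ⊗ wᵢ` to multiples of modulus one of the same basis vectors `|eᵢ⟩` and do not
mix the two values of the ancilla. Put between `V` and `W⁻¹` a gate that rotates the ancilla,
controlled by all system qubits, with upper left entry `σᵢ / ‖A‖` at `eᵢ` and `0` at all other
basis vectors. The product has upper left block `A / ‖A‖`, up to a phase in each of the `K` terms;
these phases are corrected by `K` multi-controlled phase gates applied after `V`
(`exists_block_encoding_circuit`).

*Multiplexed gates.* A single-qubit gate whose unitary depends on `l` control qubits costs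
`2 ^ l - 1` CNOT gates up to a diagonal unitary on the left (`exists_mux_circuit`). This rests on a
fact about `U(2)` (`exists_demultiplex`): any `a, b ∈ U(2)` agree up to diagonal factors with `u v`
and `u Z v`. So a gate with `l + 1` controls consists of two with `l` controls and one controlled
`Z`; the diagonal left over by the first of them commutes with the controlled `Z` and is absorbed
by the second. The rotation of the ancilla costs less than `2 ^ m` CNOT gates in this way.

*Isometries.* The circuits `V` and `W` are built one column after the other
(`exists_isometry_circuit`). The column with target `k` is swept from the least significant qubit to
the most significant one: on each system qubit a gate multiplexed over the more significant system
qubits gathers the amplitudes on the value of that bit in `k`. Since the basis vectors preceding `k`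
must be preserved, the gate is nontrivial only on the strings whose more significant bits exceed
those of `k`. This leaves a single unwanted amplitude, at `k` with the present bit flipped, which
one fully controlled gate removes (`exists_two_level_circuit`). The multiplexed gates of the sweep
cost less than `1 + 2 + ⋯ + 2 ^ (m - 1) < 2 ^ m` CNOT gates, the at most `m` fully controlled gates
`O(n)` each. The diagonals only change phases and do no harm.

*Fully controlled gates.* The condition on the controls is computed into the ancilla by a
multi-controlled NOT and uncomputed by its inverse; it is correct up to phases only, which are known
and taken into account. With one borrowed qubit it needs linearly many CNOT gates
(`exists_mcx_circuit`): a ladder of Toffoli gates, each correct up to phases only, borrows arbitrary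
other qubits and restores them.

Altogether there are at most `2 K 2 ^ m + 2 ^ m + O(K n ^ 2) = (K + 1 / 2) 2 ^ n + O(K n ^ 2)` CNOT
gates.
-/

namespace QuantumCircuit

open Matrix

section Register

variable {n : ℕ}

/-! ### Multiplexed gates and inverse circuits -/

/-- The uniformly controlled gate with target `q`: on the basis vectors whose bits away from `q`
are those of `x`, it acts on qubit `q` as the `2 × 2` matrix `R x`. This is meaningful when `R x`
does not depend on the bit `x q`. -/
def mux (q : Fin n) (R : Bits n → Matrix (Fin 2) (Fin 2) ℂ) : Matrix (Bits n) (Bits n) ℂ :=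
  Matrix.of fun x y => if ∀ p, p ≠ q → x p = y p then R x (x q) (y q) else 0

lemma agree_off_iff (q : Fin n) (x y : Bits n) :
    (∀ p, p ≠ q → x p = y p) ↔ y = Function.update x q (y q) := by
  constructor
  · intro h
    funext p
    by_cases hp : p = q
    · subst hp; simp
    · simp [hp, h p hp]
  · intro h p hp
    rw [h]; simp [hp]

lemma sum_agree_off (q : Fin n) (x : Bits n) (f : Bits n → ℂ) :
    (∑ z, if ∀ p, p ≠ q → x p = z p then f z else 0) = ∑ b, f (Function.update x q b) := by
  classical
  rw [← Finset.sum_filter]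
  symm
  refine Finset.sum_bij (fun b _ => Function.update x q b) ?_ ?_ ?_ ?_
  · intro b _
    simp only [Finset.mem_filter, Finset.mem_univ, true_and]
    intro p hp; simp [hp]
  · intro b _ b' _ h
    have := congrFun h q
    simpa using this
  · intro z hz
    simp only [Finset.mem_filter, Finset.mem_univ, true_and] at hz
    exact ⟨z q, Finset.mem_univ _, ((agree_off_iff q x z).1 hz).symm⟩
  · intros; rfl

lemma mux_mulVec (q : Fin n) (R : Bits n → Matrix (Fin 2) (Fin 2) ℂ) (ψ : Bits n → ℂ)
    (x : Bits n) :
    (mux q R *ᵥ ψ) x = ∑ b, R x (x q) b * ψ (Function.update x q b) := by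
  have := sum_agree_off q x (fun z => R x (x q) (z q) * ψ z)
  simp only [Function.update_self] at this
  rw [← this]
  simp [mux, Matrix.mulVec, dotProduct, ite_mul]

lemma mux_mul (q : Fin n) (R S : Bits n → Matrix (Fin 2) (Fin 2) ℂ)
    (hS : ∀ x b, S (Function.update x q b) = S x) :
    mux q R * mux q S = mux q (fun x => R x * S x) := by
  ext x y
  have h1 : (mux q R * mux q S) x y = (mux q R *ᵥ (fun z => mux q S z y)) x := rfl
  rw [h1, mux_mulVec]
  have h2 : ∀ b, (∀ p, p ≠ q → Function.update x q b p = y p) ↔ (∀ p, p ≠ q → x p = y p) := by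
    intro b
    refine forall_congr' fun p => forall_congr' fun hp => ?_
    simp [hp]
  simp only [mux, Matrix.of_apply, h2, hS, Function.update_self]
  split_ifs with h
  · simp [Matrix.mul_apply]
  · simp

lemma mux_one (q : Fin n) : mux q (fun _ => 1) = 1 := by
  ext x y
  simp only [mux, Matrix.of_apply, Matrix.one_apply]
  by_cases hxy : x = y
  · simp [hxy]
  · by_cases h : ∀ p, p ≠ q → x p = y p
    · have : x q ≠ y q := by
        intro hq
        apply hxy
        funext p
        by_cases hp : p = q
        · rw [hp, hq]
        · exact h p hp
      simp [hxy, this]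
    · simp [hxy, h]

lemma mux_conjTranspose (q : Fin n) (R : Bits n → Matrix (Fin 2) (Fin 2) ℂ)
    (hR : ∀ x b, R (Function.update x q b) = R x) :
    (mux q R)ᴴ = mux q (fun x => (R x)ᴴ) := by
  ext x y
  simp only [mux, Matrix.conjTranspose_apply, Matrix.of_apply]
  by_cases h : ∀ p, p ≠ q → x p = y p
  · have h' : ∀ p, p ≠ q → y p = x p := fun p hp => (h p hp).symm
    have : R y = R x := by rw [(agree_off_iff q x y).1 h, hR]
    rw [if_pos h, if_pos h', this]
  · have h' : ¬ ∀ p, p ≠ q → y p = x p := fun h' => h fun p hp => (h' p hp).symm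
    rw [if_neg h, if_neg h', star_zero]

lemma mux_mul_diagonal (q : Fin n) (R : Bits n → Matrix (Fin 2) (Fin 2) ℂ) (D : Bits n → ℂ) :
    mux q R * Matrix.diagonal D =
      mux q (fun x => R x * Matrix.diagonal (fun b => D (Function.update x q b))) := by
  ext x y
  simp only [Matrix.mul_diagonal, mux, Matrix.of_apply]
  by_cases h : ∀ p, p ≠ q → x p = y p
  · rw [if_pos h, if_pos h, ← (agree_off_iff q x y).1 h]
  · rw [if_neg h, if_neg h, zero_mul]

lemma diagonal_mul_mux (q : Fin n) (R : Bits n → Matrix (Fin 2) (Fin 2) ℂ)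
    (ρ : Bits n → Fin 2 → ℂ) :
    mux q (fun x => Matrix.diagonal (ρ x) * R x) =
      Matrix.diagonal (fun x => ρ x (x q)) * mux q R := by
  ext x y
  simp only [Matrix.diagonal_mul, mux, Matrix.of_apply]
  split_ifs <;> simp

/-- The matrix of the NOT gate. -/
def pauliX : Matrix (Fin 2) (Fin 2) ℂ := !![0, 1; 1, 0]

lemma pauliX_mul_self : pauliX * pauliX = 1 := by
  ext i j; fin_cases i <;> fin_cases j <;> simp [pauliX]

lemma pauliX_conjTranspose : pauliXᴴ = pauliX := by
  ext i j; fin_cases i <;> fin_cases j <;> simp [pauliX]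

lemma pauliX_mem : pauliX ∈ Matrix.unitaryGroup (Fin 2) ℂ := by
  rw [Matrix.mem_unitaryGroup_iff, Matrix.star_eq_conjTranspose, pauliX_conjTranspose,
    pauliX_mul_self]

lemma pauliX_apply (i j : Fin 2) : pauliX i j = if i = j + 1 then 1 else 0 := by
  fin_cases i <;> fin_cases j <;> simp [pauliX]

lemma single_toMatrix (q : Fin n) (u : Matrix.unitaryGroup (Fin 2) ℂ) :
    (Gate.single q u).toMatrix = mux q (fun _ => (u : Matrix (Fin 2) (Fin 2) ℂ)) := rfl

lemma fin_two_cases (b : Fin 2) : b = 0 ∨ b = 1 := by fin_cases b <;> simp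

lemma eq_update_add_iff (t : Fin n) (x y : Bits n) (b : Fin 2) :
    x = Function.update y t (y t + b) ↔ (∀ p, p ≠ t → x p = y p) ∧ x t = y t + b := by
  constructor
  · intro h; subst h
    exact ⟨fun p hp => by simp [hp], by simp⟩
  · rintro ⟨h1, h2⟩
    funext p
    by_cases hp : p = t
    · subst hp; simpa using h2
    · simp [hp, h1 p hp]

lemma cnot_toMatrix (c t : Fin n) (hct : c ≠ t) :
    (Gate.cnot c t hct).toMatrix = mux t (fun x => if x c = 1 then pauliX else 1) := by
  ext x y
  simp only [Gate.toMatrix, mux, Matrix.of_apply, eq_update_add_iff]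
  by_cases h : ∀ p, p ≠ t → x p = y p
  · rw [if_pos h, h c hct]
    rcases fin_two_cases (y c) with hc | hc
    · simp only [hc, add_zero, and_iff_right h]
      simp [Matrix.one_apply]
    · simp only [hc, and_iff_right h]
      simp [pauliX_apply]
  · rw [if_neg h, if_neg]
    exact fun h' => h h'.1

lemma toMatrix_append (c d : Circuit n) :
    Circuit.toMatrix (c ++ d) = Circuit.toMatrix d * Circuit.toMatrix c := by
  induction c with
  | nil => simp [Circuit.toMatrix]
  | cons g c ih => simp only [List.cons_append, Circuit.toMatrix, ih, Matrix.mul_assoc]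

lemma cnotCount_append (c d : Circuit n) :
    Circuit.cnotCount (c ++ d) = Circuit.cnotCount c + Circuit.cnotCount d := by
  induction c with
  | nil => simp [Circuit.cnotCount]
  | cons g c ih => cases g <;> (simp only [List.cons_append, Circuit.cnotCount, ih]; try omega)

/-- The inverse of an elementary gate. -/
def Gate.inv : Gate n → Gate n
  | .single q u => .single q u⁻¹
  | .cnot c t h => .cnot c t h

/-- The circuit run backwards, with every gate inverted. -/
def Circuit.inv : Circuit n → Circuit n
  | [] => []
  | g :: gs => Circuit.inv gs ++ [g.inv]

lemma Gate.toMatrix_inv (g : Gate n) : g.inv.toMatrix = g.toMatrixᴴ := by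
  cases g with
  | single q u =>
    rw [Gate.inv, single_toMatrix, single_toMatrix, mux_conjTranspose _ _ (fun _ _ => rfl)]
    rfl
  | cnot c t h =>
    rw [Gate.inv, cnot_toMatrix, mux_conjTranspose]
    · congr 1; funext x; split_ifs <;> simp [pauliX_conjTranspose]
    · intro x b; simp [h]

lemma Gate.conjTranspose_mul_self (g : Gate n) : g.toMatrixᴴ * g.toMatrix = 1 := by
  cases g with
  | single q u =>
    rw [single_toMatrix, mux_conjTranspose _ _ (fun _ _ => rfl), mux_mul _ _ _ (fun _ _ => rfl)]
    have : (u : Matrix (Fin 2) (Fin 2) ℂ)ᴴ * u = 1 := by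
      rw [← Matrix.star_eq_conjTranspose]
      exact Matrix.UnitaryGroup.star_mul_self u
    simp [this, mux_one]
  | cnot c t h =>
    have hS : ∀ (x : Bits n) b, (if (Function.update x t b) c = 1 then pauliX else 1) =
        (if x c = 1 then pauliX else 1) := by
      intro x b; simp [h]
    rw [cnot_toMatrix, mux_conjTranspose _ _ hS, mux_mul _ _ _ hS, ← mux_one t]
    congr 1; funext x; split_ifs <;> simp [pauliX_conjTranspose, pauliX_mul_self]

lemma Circuit.toMatrix_inv (c : Circuit n) :
    Circuit.toMatrix (Circuit.inv c) = (Circuit.toMatrix c)ᴴ := by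
  induction c with
  | nil => simp [Circuit.inv, Circuit.toMatrix]
  | cons g c ih =>
    simp [Circuit.inv, toMatrix_append, Circuit.toMatrix, ih, Gate.toMatrix_inv,
      Matrix.conjTranspose_mul]

lemma Circuit.cnotCount_inv (c : Circuit n) :
    Circuit.cnotCount (Circuit.inv c) = Circuit.cnotCount c := by
  induction c with
  | nil => rfl
  | cons g c ih =>
    cases g <;> simp [Circuit.inv, cnotCount_append, Circuit.cnotCount, ih, Gate.inv]

lemma Circuit.conjTranspose_mul_self (c : Circuit n) :
    (Circuit.toMatrix c)ᴴ * Circuit.toMatrix c = 1 := by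
  induction c with
  | nil => simp [Circuit.toMatrix]
  | cons g c ih =>
    rw [Circuit.toMatrix, Matrix.conjTranspose_mul, Matrix.mul_assoc,
      ← Matrix.mul_assoc (Circuit.toMatrix c)ᴴ, ih, Matrix.one_mul, Gate.conjTranspose_mul_self]

lemma Circuit.toMatrix_mem_unitaryGroup (c : Circuit n) :
    Circuit.toMatrix c ∈ Matrix.unitaryGroup (Bits n) ℂ :=
  Matrix.mem_unitaryGroup_iff'.2 (Circuit.conjTranspose_mul_self c)

/-! ### Demultiplexing up to a diagonal -/

/-- The Pauli matrix `Z = diag(1, -1)`. -/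
def pauliZ : Matrix (Fin 2) (Fin 2) ℂ := Matrix.diagonal ![1, -1]

lemma pauliZ_eq : pauliZ = !![1, 0; 0, -1] := by
  ext i j; fin_cases i <;> fin_cases j <;> simp [pauliZ]

/-- The Hadamard matrix. -/
noncomputable def hadamard : Matrix (Fin 2) (Fin 2) ℂ :=
  ((Real.sqrt 2 : ℝ) : ℂ)⁻¹ • !![1, 1; 1, -1]

lemma sqrt_two_inv_sq : ((Real.sqrt 2 : ℝ) : ℂ)⁻¹ * ((Real.sqrt 2 : ℝ) : ℂ)⁻¹ = 1 / 2 := by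
  rw [← mul_inv, ← Complex.ofReal_mul, Real.mul_self_sqrt (by norm_num)]
  norm_num

lemma hadamard_mul_self : hadamard * hadamard = 1 := by
  rw [hadamard, Matrix.smul_mul, Matrix.mul_smul, smul_smul, sqrt_two_inv_sq]
  ext i j; fin_cases i <;> fin_cases j <;> norm_num [Matrix.mul_apply]

lemma hadamard_mul_pauliX_mul : hadamard * pauliX * hadamard = pauliZ := by
  rw [hadamard, Matrix.smul_mul, Matrix.mul_smul, Matrix.smul_mul, smul_smul, sqrt_two_inv_sq]
  ext i j; fin_cases i <;> fin_cases j <;> norm_num [Matrix.mul_apply, pauliX, pauliZ]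

lemma hadamard_mem : hadamard ∈ Matrix.unitaryGroup (Fin 2) ℂ := by
  have : hadamardᴴ = hadamard := by
    ext i j; fin_cases i <;> fin_cases j <;> simp [hadamard]
  rw [Matrix.mem_unitaryGroup_iff, Matrix.star_eq_conjTranspose, this, hadamard_mul_self]

lemma diagonal_mem_unitaryGroup {ι : Type*} [Fintype ι] [DecidableEq ι] {r : ι → ℂ}
    (hr : ∀ b, ‖r b‖ = 1) : Matrix.diagonal r ∈ Matrix.unitaryGroup ι ℂ := by
  rw [Matrix.mem_unitaryGroup_iff, Matrix.star_eq_conjTranspose, Matrix.diagonal_conjTranspose,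
    Matrix.diagonal_mul_diagonal, ← Matrix.diagonal_one]
  congr 1; funext b
  simp [Complex.mul_conj', hr b]

lemma exists_unit_sq_eq {w : ℂ} (hw : ‖w‖ = 1) : ∃ r : ℂ, r ^ 2 = w ∧ ‖r‖ = 1 := by
  obtain ⟨r, hr⟩ := IsAlgClosed.exists_pow_nat_eq w (n := 2) (by norm_num)
  refine ⟨r, hr, ?_⟩
  have : ‖r‖ ^ 2 = 1 := by rw [← norm_pow, hr, hw]
  exact (pow_eq_one_iff_of_nonneg (norm_nonneg r) (by norm_num)).1 this

lemma exists_unit_mul_norm (z : ℂ) : ∃ w : ℂ, ‖w‖ = 1 ∧ z = w * (‖z‖ : ℂ) :=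
  ⟨Complex.exp (z.arg * Complex.I), Complex.norm_exp_ofReal_mul_I _, by
    rw [mul_comm]; exact (Complex.norm_mul_exp_arg_mul_I z).symm⟩

lemma unit_mul_conj {w : ℂ} (hw : ‖w‖ = 1) : w * (starRingEnd ℂ) w = 1 := by
  simp [Complex.mul_conj', hw]

/-- A traceless Hermitian unitary `[[c, z], [z̄, -c]]` with `c ≥ 0` is unitarily similar to `Z`;
the condition on `c` keeps the eigenvector `(1 + c, z̄)` away from zero. -/
lemma exists_unitary_conj_pauliZ {c : ℝ} {z : ℂ} (hc : 0 ≤ c)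
    (h : (c : ℂ) * c + z * (starRingEnd ℂ) z = 1) :
    ∃ u ∈ Matrix.unitaryGroup (Fin 2) ℂ,
      u * pauliZ * uᴴ = !![(c : ℂ), z; (starRingEnd ℂ) z, -c] := by
  -- The columns of `M` below are the eigenvectors; their squared norm is `2 + 2 c`.
  set t : ℂ := ((Real.sqrt (2 + 2 * c) : ℝ) : ℂ)⁻¹ with ht
  have hpos : (0 : ℝ) < 2 + 2 * c := by linarith
  have hne : (2 + 2 * (c : ℂ)) ≠ 0 := by exact_mod_cast hpos.ne'
  have htt : t * t = (2 + 2 * (c : ℂ))⁻¹ := by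
    rw [ht, ← mul_inv, ← Complex.ofReal_mul, Real.mul_self_sqrt hpos.le]
    norm_num
  have hz : z * (starRingEnd ℂ) z = 1 - (c : ℂ) * c := by linear_combination h
  set M : Matrix (Fin 2) (Fin 2) ℂ := !![1 + (c : ℂ), -z; (starRingEnd ℂ) z, 1 + c] with hM
  have hMM : (t • M)ᴴ = t • Mᴴ := by
    rw [Matrix.conjTranspose_smul, ht, star_inv₀, Complex.star_def, Complex.conj_ofReal]
  have hMd : Mᴴ = !![1 + (c : ℂ), z; -(starRingEnd ℂ) z, 1 + c] := by
    ext i j; fin_cases i <;> fin_cases j <;> simp [hM]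
  refine ⟨t • M, ?_, ?_⟩
  · rw [Matrix.mem_unitaryGroup_iff, Matrix.star_eq_conjTranspose, hMM, Matrix.smul_mul,
      Matrix.mul_smul, smul_smul, htt, inv_smul_eq_iff₀ hne, hMd, hM]
    ext i j
    fin_cases i <;> fin_cases j <;> simp [Matrix.mul_apply, Fin.sum_univ_two]
    · linear_combination hz
    · ring
    · ring
    · linear_combination hz
  · rw [hMM, Matrix.smul_mul, Matrix.smul_mul, Matrix.mul_smul, smul_smul, htt,
      inv_smul_eq_iff₀ hne, hMd, hM, pauliZ_eq]
    ext i j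
    fin_cases i <;> fin_cases j <;> simp [Matrix.mul_apply, Fin.sum_univ_two]
    · linear_combination -hz
    · ring
    · ring
    · linear_combination hz

/-- Multiplying a `2 × 2` unitary on both sides by the same suitable diagonal unitary makes it
Hermitian and traceless, hence unitarily similar to `Z`. -/
lemma exists_diagonal_conj_pauliZ {Y : Matrix (Fin 2) (Fin 2) ℂ}
    (hY : Y ∈ Matrix.unitaryGroup (Fin 2) ℂ) :
    ∃ (r : Fin 2 → ℂ) (u : Matrix (Fin 2) (Fin 2) ℂ), (∀ b, ‖r b‖ = 1) ∧
      u ∈ Matrix.unitaryGroup (Fin 2) ℂ ∧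
      Matrix.diagonal r * (u * pauliZ * uᴴ) * Matrix.diagonal r = Y := by
  have hYY : Y * Yᴴ = 1 := by
    rw [← Matrix.star_eq_conjTranspose]; exact Matrix.mem_unitaryGroup_iff.1 hY
  have hadj : Y.adjugate = Y.det • Yᴴ := by
    calc Y.adjugate = Y.adjugate * (Y * Yᴴ) := by rw [hYY, Matrix.mul_one]
      _ = Y.det • Yᴴ := by
        rw [← Matrix.mul_assoc, Matrix.adjugate_mul, Matrix.smul_mul, Matrix.one_mul]
  have hdet : ‖Y.det‖ = 1 := by
    have h1 : Y.det * (starRingEnd ℂ) Y.det = 1 := by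
      have := congrArg Matrix.det hYY
      rwa [Matrix.det_mul, Matrix.det_conjTranspose, Matrix.det_one] at this
    rw [Complex.mul_conj'] at h1
    have h2 : ‖Y.det‖ ^ 2 = 1 := by exact_mod_cast h1
    exact (pow_eq_one_iff_of_nonneg (norm_nonneg _) (by norm_num)).1 h2
  have h11 : Y 1 1 = Y.det * (starRingEnd ℂ) (Y 0 0) := by
    have := congrFun (congrFun hadj 0) 0
    simpa [Matrix.adjugate_fin_two] using this
  have h10 : Y 1 0 = -(Y.det * (starRingEnd ℂ) (Y 0 1)) := by
    have := congrFun (congrFun hadj 1) 0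
    simp only [Matrix.adjugate_fin_two] at this
    have h' : -Y 1 0 = Y.det * (starRingEnd ℂ) (Y 0 1) := by simpa using this
    rw [← h', neg_neg]
  have hrow : Y 0 0 * (starRingEnd ℂ) (Y 0 0) + Y 0 1 * (starRingEnd ℂ) (Y 0 1) = 1 := by
    have := congrFun (congrFun hYY 0) 0
    simpa [Matrix.mul_apply, Fin.sum_univ_two] using this
  -- `r0` makes the upper left entry real and nonnegative; `r1` then makes the determinant `-1`.
  obtain ⟨w, hw, hw0⟩ := exists_unit_mul_norm (Y 0 0)
  obtain ⟨r0, hr0, hr0n⟩ := exists_unit_sq_eq hw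
  obtain ⟨r1, hr1, hr1n⟩ := exists_unit_sq_eq (w := -(Y.det * (starRingEnd ℂ) w))
    (by rw [norm_neg, norm_mul, hdet, one_mul, RCLike.norm_conj, hw])
  have hwc := unit_mul_conj hw
  have h0c := unit_mul_conj hr0n
  have h1c := unit_mul_conj hr1n
  set z : ℂ := (starRingEnd ℂ) r0 * (starRingEnd ℂ) r1 * Y 0 1 with hz
  have hzc : (starRingEnd ℂ) z = r0 * r1 * (starRingEnd ℂ) (Y 0 1) := by simp [hz]
  obtain ⟨u, hu, huZ⟩ := exists_unitary_conj_pauliZ (c := ‖Y 0 0‖) (z := z) (norm_nonneg _) (by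
    rw [hzc, hz]
    have e1 : (‖Y 0 0‖ : ℂ) * ‖Y 0 0‖ = Y 0 0 * (starRingEnd ℂ) (Y 0 0) := by
      rw [Complex.mul_conj']; ring
    rw [e1, ← hrow]
    linear_combination (Y 0 1 * (starRingEnd ℂ) (Y 0 1) * r1 * (starRingEnd ℂ) r1) * h0c +
      (Y 0 1 * (starRingEnd ℂ) (Y 0 1)) * h1c)
  refine ⟨![r0, r1], u, ?_, hu, ?_⟩
  · intro b; fin_cases b <;> simp [hr0n, hr1n]
  · rw [huZ, hzc, hz]
    set N : ℂ := (‖Y 0 0‖ : ℂ) with hN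
    have hNc : (starRingEnd ℂ) N = N := Complex.conj_ofReal _
    have hc00 : (starRingEnd ℂ) (Y 0 0) = (starRingEnd ℂ) w * N := by
      rw [hw0, map_mul, hNc]
    ext i j
    fin_cases i <;> fin_cases j <;>
      simp only [Matrix.mul_diagonal, Matrix.diagonal_mul, Fin.zero_eta, Fin.mk_one,
        Matrix.of_apply, Matrix.cons_val_zero, Matrix.cons_val_one, Matrix.cons_val',
        Matrix.cons_val_fin_one]
    · linear_combination N * hr0 - hw0
    · linear_combination (Y 0 1 * r1 * (starRingEnd ℂ) r1) * h0c + Y 0 1 * h1c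
    · rw [h10]
      linear_combination (r1 ^ 2 * (starRingEnd ℂ) (Y 0 1)) * hr0 +
        (w * (starRingEnd ℂ) (Y 0 1)) * hr1 - (Y.det * (starRingEnd ℂ) (Y 0 1)) * hwc
    · rw [h11, hc00]
      linear_combination (-N) * hr1

/-- Any two `2 × 2` unitaries are, up to diagonal factors on the left, of the form `u * v` and
`u * Z * v`: one controlled `Z` turns a pair of single-qubit gates into a multiplexed gate. -/
lemma exists_demultiplex {a b : Matrix (Fin 2) (Fin 2) ℂ}
    (ha : a ∈ Matrix.unitaryGroup (Fin 2) ℂ) (hb : b ∈ Matrix.unitaryGroup (Fin 2) ℂ) :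
    ∃ (r : Fin 2 → ℂ) (u v : Matrix (Fin 2) (Fin 2) ℂ), (∀ i, ‖r i‖ = 1) ∧
      u ∈ Matrix.unitaryGroup (Fin 2) ℂ ∧ v ∈ Matrix.unitaryGroup (Fin 2) ℂ ∧
      u * v = Matrix.diagonal r * a ∧
      u * pauliZ * v = Matrix.diagonal (fun i => (starRingEnd ℂ) (r i)) * b := by
  have haa : star a * a = 1 := Matrix.mem_unitaryGroup_iff'.1 ha
  obtain ⟨r, u, hr, hu, hY⟩ := exists_diagonal_conj_pauliZ (mul_mem hb (Unitary.star_mem ha))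
  have huu : u * uᴴ = 1 := by
    rw [← Matrix.star_eq_conjTranspose]; exact Matrix.mem_unitaryGroup_iff.1 hu
  have hD := diagonal_mem_unitaryGroup hr
  refine ⟨r, u, uᴴ * (Matrix.diagonal r * a), hr, hu, ?_, ?_, ?_⟩
  · rw [← Matrix.star_eq_conjTranspose]
    exact mul_mem (Unitary.star_mem hu) (mul_mem hD ha)
  · rw [← Matrix.mul_assoc, huu, Matrix.one_mul]
  · have hb' : b = Matrix.diagonal r * (u * pauliZ * uᴴ) * Matrix.diagonal r * a := by
      rw [hY, Matrix.mul_assoc, haa, Matrix.mul_one]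
    have hD' : Matrix.diagonal (fun i => (starRingEnd ℂ) (r i)) * Matrix.diagonal r = 1 := by
      rw [Matrix.diagonal_mul_diagonal, ← Matrix.diagonal_one]
      congr 1; funext i
      rw [mul_comm]; exact unit_mul_conj (hr i)
    conv_rhs => rw [hb']
    simp only [← Matrix.mul_assoc]
    rw [hD', Matrix.one_mul]

lemma update_agree {L : Finset (Fin n)} {q : Fin n} {x y : Bits n}
    (h : ∀ p ∈ L, x p = y p) (b : Fin 2) :
    ∀ p ∈ insert q L, Function.update x q b p = Function.update y q b p := by
  intro p hp
  by_cases hpq : p = q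
  · subst hpq; simp
  · simp [hpq, h p ((Finset.mem_insert.1 hp).resolve_left hpq)]

/-- The controlled `Z` with one CNOT. -/
lemma exists_cz_circuit (p q : Fin n) (hpq : p ≠ q) :
    ∃ c : Circuit n, c.cnotCount = 1 ∧
      c.toMatrix = mux q (fun x => if x p = 1 then pauliZ else 1) := by
  refine ⟨[.single q ⟨_, hadamard_mem⟩, .cnot p q hpq, .single q ⟨_, hadamard_mem⟩], rfl, ?_⟩
  simp only [Circuit.toMatrix, cnot_toMatrix, single_toMatrix, Matrix.one_mul]
  rw [mux_mul _ _ _ (by intro x b; simp [hpq]), mux_mul _ _ _ (by intro x b; rfl)]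
  congr 1; funext x
  split_ifs
  · exact hadamard_mul_pauliX_mul
  · simp [hadamard_mul_self]

lemma mux_pauliZ_eq_diagonal (p q : Fin n) :
    mux q (fun x => if x p = 1 then pauliZ else 1) =
      Matrix.diagonal (fun x : Bits n => if x p = 1 then (![1, -1] : Fin 2 → ℂ) (x q) else 1) := by
  have := diagonal_mul_mux q (fun _ : Bits n => (1 : Matrix (Fin 2) (Fin 2) ℂ))
    (fun x => if x p = 1 then ![1, -1] else 1)
  rw [mux_one, Matrix.mul_one] at this
  convert this using 2
  · funext x
    split_ifs
    · simp [pauliZ]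
    · simp
  · funext x
    split_ifs <;> simp

/-- A uniformly controlled gate with control set `L` can be implemented up to a diagonal unitary
with `2 ^ |L| - 1` CNOT gates. The diagonal depends on the controls and the target only, so that
it can be absorbed into later gates. -/
theorem exists_mux_circuit (q : Fin n) (L : Finset (Fin n)) :
    q ∉ L → ∀ (R : Bits n → Matrix (Fin 2) (Fin 2) ℂ),
    (∀ x, R x ∈ Matrix.unitaryGroup (Fin 2) ℂ) →
    (∀ x y, (∀ p ∈ L, x p = y p) → R x = R y) →
    ∃ (c : Circuit n) (D : Bits n → ℂ), c.cnotCount + 1 ≤ 2 ^ L.card ∧ (∀ x, ‖D x‖ = 1) ∧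
      (∀ x y, (∀ p ∈ insert q L, x p = y p) → D x = D y) ∧
      c.toMatrix = Matrix.diagonal D * mux q R := by
  classical
  induction L using Finset.induction with
  | empty =>
    intro _ R hRu hR
    refine ⟨[.single q ⟨R 0, hRu 0⟩], fun _ => 1, by simp [Circuit.cnotCount], by simp, by simp, ?_⟩
    rw [Matrix.diagonal_one, Matrix.one_mul, Circuit.toMatrix, Circuit.toMatrix, single_toMatrix,
      Matrix.one_mul]
    congr 1; funext x
    exact hR _ _ (by simp)
  | insert p L hpL ih =>
    intro hq R hRu hR
    have hpq : p ≠ q := fun h => hq (by simp [h])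
    have hqL : q ∉ L := fun h => hq (by simp [h])
    choose r u v hr hu hv huv huzv using fun x : Bits n =>
      exists_demultiplex (hRu (Function.update x p 0)) (hRu (Function.update x p 1))
    -- The factors have to be chosen as functions of the controls alone: they are read off at a
    -- representative of each class of bit strings.
    let rep : Bits n → Bits n := fun x t => if t ∈ L then x t else 0
    have hrep : ∀ x y : Bits n, (∀ t ∈ L, x t = y t) → rep x = rep y := by
      intro x y h; funext t
      by_cases ht : t ∈ L
      · simp [rep, ht, h t ht]
      · simp [rep, ht]
    have hrepR : ∀ x b, R (Function.update (rep x) p b) = R (Function.update x p b) := by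
      intro x b
      refine hR _ _ fun t ht => update_agree (fun s hs => ?_) b t ht
      simp [rep, hs]
    obtain ⟨cv, Dv, hcv, hDv, hDvL, hcvM⟩ := ih hqL (fun x => v (rep x)) (fun x => hv _)
      (fun x y h => by simp only [hrep x y h])
    obtain ⟨cz, hcz, hczM⟩ := exists_cz_circuit p q hpq
    -- The diagonal `Dv` commutes with the controlled `Z`; its inverse is built into `u`.
    obtain ⟨cu, Du, hcu, hDu, hDuL, hcuM⟩ := ih hqL
      (fun x => u (rep x) * Matrix.diagonal fun b => (starRingEnd ℂ) (Dv (Function.update x q b)))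
      (fun x => mul_mem (hu _) (diagonal_mem_unitaryGroup fun b => by
        rw [RCLike.norm_conj]; exact hDv _))
      (fun x y h => by
        simp only [hrep x y h]
        congr 2; funext b
        rw [hDvL _ _ (update_agree h b)])
    refine ⟨cv ++ (cz ++ cu), fun x => Du x * (if x p = 1 then
        (starRingEnd ℂ) (r (rep x) (x q)) else r (rep x) (x q)), ?_, ?_, ?_, ?_⟩
    · rw [cnotCount_append, cnotCount_append, Finset.card_insert_of_notMem hpL, pow_succ]
      omega
    · intro x
      beta_reduce
      split_ifs <;> simp [hDu, hr]
    · intro x y h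
      have hL : ∀ t ∈ L, x t = y t := fun t ht => h t (by simp [ht])
      have hqx : x q = y q := h q (by simp)
      have hpx : x p = y p := h p (by simp)
      beta_reduce
      rw [hrep x y hL, hqx, hpx, hDuL x y fun t ht => ?_]
      rcases Finset.mem_insert.1 ht with rfl | ht
      · exact hqx
      · exact hL t ht
    · rw [toMatrix_append, toMatrix_append, hcvM, hczM, hcuM]
      have hcomm : mux q (fun x => if x p = 1 then pauliZ else 1) * Matrix.diagonal Dv =
          Matrix.diagonal Dv * mux q (fun x => if x p = 1 then pauliZ else 1) := by
        rw [mux_pauliZ_eq_diagonal, Matrix.diagonal_mul_diagonal, Matrix.diagonal_mul_diagonal]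
        simp only [mul_comm]
      have habs : mux q (fun x => u (rep x) *
            Matrix.diagonal fun b => (starRingEnd ℂ) (Dv (Function.update x q b))) *
          Matrix.diagonal Dv = mux q (fun x => u (rep x)) := by
        rw [mux_mul_diagonal]
        congr 1; funext x
        rw [Matrix.mul_assoc, Matrix.diagonal_mul_diagonal]
        have : (fun b => (starRingEnd ℂ) (Dv (Function.update x q b)) *
            Dv (Function.update x q b)) = fun _ => 1 := by
          funext b; rw [mul_comm]; exact unit_mul_conj (hDv _)
        rw [this, Matrix.diagonal_one, Matrix.mul_one]
      have hrepq : ∀ x b, rep (Function.update x q b) = rep x := by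
        intro x b
        refine hrep _ _ fun t ht => ?_
        have : t ≠ q := fun h => hqL (h ▸ ht)
        simp [this]
      have hmid : mux q (fun x => u (rep x)) * mux q (fun x => if x p = 1 then pauliZ else 1) *
          mux q (fun x => v (rep x)) = Matrix.diagonal (fun x => if x p = 1 then
            (starRingEnd ℂ) (r (rep x) (x q)) else r (rep x) (x q)) * mux q R := by
        rw [mux_mul _ _ _ (by intro x b; simp [hpq]),
          mux_mul _ _ _ (by intro x b; simp only [hrepq])]
        rw [show (fun x : Bits n => if x p = 1 then
            (starRingEnd ℂ) (r (rep x) (x q)) else r (rep x) (x q)) = fun x =>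
            (if x p = 1 then fun i => (starRingEnd ℂ) (r (rep x) i) else r (rep x)) (x q) by
              funext x; split_ifs <;> rfl,
          ← diagonal_mul_mux q R (fun x =>
            if x p = 1 then fun i => (starRingEnd ℂ) (r (rep x) i) else r (rep x))]
        congr 1; funext x
        rcases fin_two_cases (x p) with h | h
        · have hx : Function.update x p 0 = x := by rw [← h, Function.update_eq_self]
          simp only [h, zero_ne_one, if_false, Matrix.mul_one]
          rw [huv, hrepR, hx]
        · have hx : Function.update x p 1 = x := by rw [← h, Function.update_eq_self]
          simp only [h, if_true]
          rw [huzv, hrepR, hx]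
      calc _ = Matrix.diagonal Du * (mux q (fun x => u (rep x) *
            Matrix.diagonal fun b => (starRingEnd ℂ) (Dv (Function.update x q b))) *
            (mux q (fun x => if x p = 1 then pauliZ else 1) * Matrix.diagonal Dv) *
            mux q (fun x => v (rep x))) := by simp only [Matrix.mul_assoc]
        _ = Matrix.diagonal Du * (mux q (fun x => u (rep x)) *
            mux q (fun x => if x p = 1 then pauliZ else 1) * mux q (fun x => v (rep x))) := by
          rw [hcomm, ← Matrix.mul_assoc (mux q _) (Matrix.diagonal Dv), habs]
        _ = _ := by rw [hmid, ← Matrix.mul_assoc, Matrix.diagonal_mul_diagonal]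

/-! ### Permutations up to phases and multi-controlled NOT gates -/

open scoped Classical in
/-- The bit that is `1` exactly when `P` holds. -/
noncomputable def indicatorBit (P : Prop) : Fin 2 := if P then 1 else 0

lemma indicatorBit_of_true {P : Prop} (h : P) : indicatorBit P = 1 := if_pos h

lemma indicatorBit_of_false {P : Prop} (h : ¬ P) : indicatorBit P = 0 := if_neg h

lemma fin_two_add_self (b : Fin 2) : b + b = 0 := by fin_cases b <;> rfl

/-- Flip bit `t` of those bit strings that satisfy `P`. -/
noncomputable def flipIf (t : Fin n) (P : Bits n → Prop) (y : Bits n) : Bits n :=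
  Function.update y t (y t + indicatorBit (P y))

/-- The circuit maps each basis vector `|y⟩` to a multiple of modulus one of `|π y⟩`. -/
def PermUpToPhase (c : Circuit n) (π : Bits n → Bits n) : Prop :=
  ∃ φ : Bits n → ℂ, (∀ y, ‖φ y‖ = 1) ∧ ∀ x y, c.toMatrix x y = if x = π y then φ y else 0

lemma PermUpToPhase.nil : PermUpToPhase ([] : Circuit n) id :=
  ⟨fun _ => 1, by simp, fun x y => by simp [Circuit.toMatrix, Matrix.one_apply]⟩

lemma PermUpToPhase.append {c d : Circuit n} {π ρ : Bits n → Bits n}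
    (hc : PermUpToPhase c π) (hd : PermUpToPhase d ρ) : PermUpToPhase (c ++ d) (ρ ∘ π) := by
  obtain ⟨φ, hφ, hc⟩ := hc
  obtain ⟨ψ, hψ, hd⟩ := hd
  refine ⟨fun y => ψ (π y) * φ y, fun y => by simp [hφ, hψ], fun x y => ?_⟩
  simp only [toMatrix_append, Matrix.mul_apply, hc, hd, mul_ite, mul_zero, Finset.sum_ite_eq',
    Finset.mem_univ, if_true, Function.comp, ite_mul, zero_mul]

lemma exists_flipIf_circuit (t : Fin n) (L : Finset (Fin n)) (ht : t ∉ L) (P : Bits n → Prop)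
    (hP : ∀ x y, (∀ p ∈ L, x p = y p) → (P x ↔ P y)) :
    ∃ c : Circuit n, c.cnotCount + 1 ≤ 2 ^ L.card ∧ PermUpToPhase c (flipIf t P) := by
  classical
  obtain ⟨c, D, hc, hD, -, hM⟩ := exists_mux_circuit t L ht (fun x => if P x then pauliX else 1)
    (fun x => by
      split_ifs
      · exact pauliX_mem
      · exact one_mem _)
    (fun x y h => by simp only [hP x y h])
  refine ⟨c, hc, fun y => D (flipIf t P y), fun y => hD _, fun x y => ?_⟩
  rw [hM, Matrix.diagonal_mul]
  simp only [mux, Matrix.of_apply, flipIf, eq_update_add_iff]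
  by_cases h : ∀ p, p ≠ t → x p = y p
  · have hPxy : P x ↔ P y := hP x y fun p hp => h p fun hpt => ht (hpt ▸ hp)
    simp only [if_pos h, and_iff_right h, hPxy]
    by_cases hy : P y
    · simp only [hy, if_true, pauliX_apply, indicatorBit_of_true]
      split_ifs with hx
      · rw [mul_one, (eq_update_add_iff t x y 1).2 ⟨h, hx⟩]
      · rw [mul_zero]
    · simp only [hy, if_false, Matrix.one_apply, indicatorBit_of_false, not_false_iff, add_zero]
      split_ifs with hx
      · have : x = y := by
          have := (eq_update_add_iff t x y 0).2 ⟨h, by simpa using hx⟩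
          simpa using this
        rw [mul_one, this, Function.update_eq_self]
      · rw [mul_zero]
  · rw [if_neg h, mul_zero, if_neg]
    exact fun h' => h h'.1

/-- The action of a ladder on bit strings. The list consists of pairs of a control and a target
bit; each target is flipped if its own control and all controls further down the list have the
values prescribed by `κ`. -/
noncomputable def ladderMap (κ : Bits n) : List (Fin n × Fin n) → Bits n → Bits n
  | [], y => y
  | e :: l, y => Function.update (ladderMap κ l y) e.2
      (y e.2 + indicatorBit (∀ p ∈ (e :: l).map Prod.fst, y p = κ p))

lemma ladderMap_apply_of_notMem (κ : Bits n) (l : List (Fin n × Fin n)) (y : Bits n) (p : Fin n)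
    (hp : p ∉ l.map Prod.snd) : ladderMap κ l y p = y p := by
  induction l with
  | nil => rfl
  | cons e l ih =>
    simp only [List.map_cons, List.mem_cons, not_or] at hp
    simp [ladderMap, hp.1, ih hp.2]

lemma ladderMap_update (κ : Bits n) (l : List (Fin n × Fin n)) (y : Bits n) (t : Fin n)
    (b : Fin 2) (h1 : t ∉ l.map Prod.fst) (h2 : t ∉ l.map Prod.snd) :
    ladderMap κ l (Function.update y t b) = Function.update (ladderMap κ l y) t b := by
  induction l with
  | nil => rfl
  | cons e l ih =>
    have h1' := h1
    simp only [List.map_cons, List.mem_cons, not_or] at h1 h2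
    have hc : (∀ p ∈ (e :: l).map Prod.fst, Function.update y t b p = κ p) ↔
        (∀ p ∈ (e :: l).map Prod.fst, y p = κ p) := by
      refine forall_congr' fun p => forall_congr' fun hp => ?_
      have : p ≠ t := fun h => h1' (h ▸ hp)
      simp [this]
    simp only [ladderMap, hc, ih h1.2 h2.2]
    rw [Function.update_of_ne (Ne.symm h2.1), Function.update_comm h2.1]

lemma ladderMap_involutive (κ : Bits n) (l : List (Fin n × Fin n))
    (hl : (l.map Prod.fst ++ l.map Prod.snd).Nodup) (y : Bits n) :
    ladderMap κ l (ladderMap κ l y) = y := by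
  induction l with
  | nil => rfl
  | cons e l ih =>
    rw [List.nodup_append] at hl
    obtain ⟨hf, hs, hd⟩ := hl
    simp only [List.map_cons, List.nodup_cons] at hf hs
    have he1 : e.2 ∉ (e :: l).map Prod.fst := fun h => hd _ h e.2 (by simp) rfl
    have he1' : e.2 ∉ l.map Prod.fst := fun h =>
      he1 (List.mem_cons_of_mem _ h)
    have hl' : (l.map Prod.fst ++ l.map Prod.snd).Nodup := by
      rw [List.nodup_append]
      exact ⟨hf.2, hs.2, fun a ha b hb => hd a (List.mem_cons_of_mem _ ha) b
        (List.mem_cons_of_mem _ hb)⟩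
    have hc : ∀ p ∈ (e :: l).map Prod.fst, ladderMap κ (e :: l) y p = y p := fun p hp =>
      ladderMap_apply_of_notMem κ _ y p fun h => hd p hp p h rfl
    have hc' : (∀ p ∈ (e :: l).map Prod.fst, ladderMap κ (e :: l) y p = κ p) ↔
        (∀ p ∈ (e :: l).map Prod.fst, y p = κ p) :=
      forall_congr' fun p => forall_congr' fun hp => by rw [hc p hp]
    rw [ladderMap, hc']
    conv_lhs => enter [1]; rw [ladderMap]
    rw [ladderMap_update _ _ _ _ _ he1' hs.1, ih hl', ladderMap, Function.update_self,
      Function.update_idem, add_assoc, fin_two_add_self, add_zero, Function.update_eq_self]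

/-- The recursion behind the ladder: conjugating with a Toffoli gate whose source is the top target
of a shorter ladder adds one rung. The top target collects the value of its source before and
after the inner ladder, hence exactly the change of the source. -/
lemma flipIf_ladderMap_flipIf (κ : Bits n) (e e' : Fin n × Fin n) (l : List (Fin n × Fin n))
    (hl : ((e :: e' :: l).map Prod.fst ++ (e :: e' :: l).map Prod.snd).Nodup) (y : Bits n) :
    flipIf e.2 (fun y => y e.1 = κ e.1 ∧ y e'.2 = 1) (ladderMap κ (e' :: l)
      (flipIf e.2 (fun y => y e.1 = κ e.1 ∧ y e'.2 = 1) y)) = ladderMap κ (e :: e' :: l) y := by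
  rw [List.nodup_append] at hl
  obtain ⟨hf, hs, hd⟩ := hl
  have ht1 : e.2 ∉ (e' :: l).map Prod.fst := fun h =>
    hd _ (by rw [List.map_cons]; exact List.mem_cons_of_mem _ h) e.2 (by simp) rfl
  have ht2 : e.2 ∉ (e' :: l).map Prod.snd := by
    rw [List.map_cons, List.nodup_cons] at hs; exact hs.1
  have hx2 : e.1 ∉ (e' :: l).map Prod.snd := fun h =>
    hd e.1 (by simp) _ (by rw [List.map_cons]; exact List.mem_cons_of_mem _ h) rfl
  have hxt : e.1 ≠ e.2 := fun h => hd e.1 (by simp) e.2 (by simp) h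
  have htt : e'.2 ≠ e.2 := fun h => ht2 (by simp [← h])
  have hsrc : ladderMap κ (e' :: l) y e'.2 =
      y e'.2 + indicatorBit (∀ p ∈ (e' :: l).map Prod.fst, y p = κ p) := by
    rw [ladderMap, Function.update_self]
  have hall : (∀ p ∈ (e :: e' :: l).map Prod.fst, y p = κ p) ↔
      y e.1 = κ e.1 ∧ ∀ p ∈ (e' :: l).map Prod.fst, y p = κ p := by
    rw [List.map_cons, List.forall_mem_cons]
  conv_rhs => rw [ladderMap]
  conv_lhs => enter [3, 3]; rw [flipIf]
  rw [ladderMap_update _ _ _ _ _ ht1 ht2, flipIf, Function.update_idem, Function.update_self,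
    Function.update_of_ne hxt, Function.update_of_ne htt,
    ladderMap_apply_of_notMem _ _ _ _ hx2, hsrc]
  congr 1
  rw [add_assoc]
  congr 1
  rw [hall]
  by_cases h1 : y e.1 = κ e.1
  · by_cases h2 : ∀ p ∈ (e' :: l).map Prod.fst, y p = κ p
    · rw [indicatorBit_of_true h2, indicatorBit_of_true (show _ ∧ _ from ⟨h1, h2⟩)]
      rcases fin_two_cases (y e'.2) with h | h <;> simp [h, h1, indicatorBit]
    · rw [indicatorBit_of_false h2, add_zero, fin_two_add_self,
        indicatorBit_of_false (fun h => h2 h.2)]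
  · simp [h1, indicatorBit]

lemma exists_ladder_circuit (κ : Bits n) (l : List (Fin n × Fin n))
    (hl : (l.map Prod.fst ++ l.map Prod.snd).Nodup) :
    ∃ c : Circuit n, c.cnotCount ≤ 6 * l.length ∧ PermUpToPhase c (ladderMap κ l) := by
  induction l with
  | nil => exact ⟨[], by simp [Circuit.cnotCount], PermUpToPhase.nil⟩
  | cons e l ih =>
    have hd := (List.nodup_append.1 hl).2.2
    have hxt : e.1 ≠ e.2 := fun h => hd e.1 (by simp) e.2 (by simp) h
    cases l with
    | nil =>
      obtain ⟨c, hc, hP⟩ := exists_flipIf_circuit e.2 {e.1} (by simpa using hxt.symm)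
        (fun y => y e.1 = κ e.1) (fun x y h => by rw [h e.1 (by simp)])
      refine ⟨c, ?_, ?_⟩
      · simp only [Finset.card_singleton] at hc
        simp only [List.length_singleton]; omega
      · convert hP using 1
        funext y
        simp [ladderMap, flipIf]
    | cons e' l =>
      obtain ⟨w, hw, hwP⟩ := ih (by
        refine hl.sublist (List.Sublist.append ?_ ?_) <;>
          exact (List.sublist_cons_self _ _).map _)
      have ht2 : e.2 ≠ e'.2 := by
        have := (List.nodup_append.1 hl).2.1
        simp only [List.map_cons, List.nodup_cons, List.mem_cons, not_or] at this
        exact this.1.1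
      obtain ⟨c, hc, hP⟩ := exists_flipIf_circuit e.2 {e.1, e'.2} (by simp [hxt.symm, ht2])
        (fun y => y e.1 = κ e.1 ∧ y e'.2 = 1)
        (fun x y h => by rw [h e.1 (by simp), h e'.2 (by simp)])
      refine ⟨c ++ (w ++ c), ?_, ?_⟩
      · have h2 : ({e.1, e'.2} : Finset (Fin n)).card ≤ 2 := Finset.card_le_two
        have : 2 ^ ({e.1, e'.2} : Finset (Fin n)).card ≤ 2 ^ 2 :=
          Nat.pow_le_pow_right (by norm_num) h2
        simp only [cnotCount_append, List.length_cons] at hw ⊢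
        omega
      · convert hP.append (hwP.append hP) using 1
        funext y
        exact (flipIf_ladderMap_flipIf κ e e' l hl y).symm

/-- A multi-controlled NOT up to phases, with borrowed bits that may be in any state: the ladder
restores them when it is followed by the ladder without its top rung. -/
lemma exists_mcx_circuit_of_many_borrowed (κ : Bits n) (t : Fin n) (L B : Finset (Fin n))
    (htL : t ∉ L) (htB : t ∉ B) (hLB : Disjoint L B) (hne : L.Nonempty)
    (hcard : L.card ≤ B.card + 1) :
    ∃ c : Circuit n, c.cnotCount ≤ 12 * L.card ∧
      PermUpToPhase c (flipIf t fun y => ∀ p ∈ L, y p = κ p) := by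
  obtain ⟨x, xs, hxs⟩ : ∃ x xs, L.toList = x :: xs := by
    cases h : L.toList with
    | nil => simp [Finset.toList_eq_nil] at h; simp [h] at hne
    | cons x xs => exact ⟨x, xs, rfl⟩
  have hlen : xs.length + 1 = L.card := by rw [← Finset.length_toList, hxs, List.length_cons]
  have hmem : ∀ p, p ∈ x :: xs ↔ p ∈ L := fun p => by rw [← hxs, Finset.mem_toList]
  set bs := B.toList.take xs.length with hbs
  have hbsl : bs.length = xs.length := by
    rw [hbs, List.length_take, Finset.length_toList]; omega
  have hfst : (xs.zip bs).map Prod.fst = xs := List.map_fst_zip hbsl.ge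
  have hsnd : (xs.zip bs).map Prod.snd = bs := List.map_snd_zip hbsl.le
  have hbB : ∀ p ∈ bs, p ∈ B := fun p hp => Finset.mem_toList.1 (List.mem_of_mem_take hp)
  have hnd : (((x, t) :: xs.zip bs).map Prod.fst ++ ((x, t) :: xs.zip bs).map Prod.snd).Nodup := by
    rw [List.map_cons, List.map_cons, hfst, hsnd, List.nodup_append]
    refine ⟨hxs ▸ L.nodup_toList, ?_, ?_⟩
    · rw [List.nodup_cons]
      exact ⟨fun h => htB (hbB t h), B.nodup_toList.sublist (List.take_sublist _ _)⟩
    · intro a ha b hb hab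
      subst hab
      have haL := (hmem a).1 ha
      rcases List.mem_cons.1 hb with rfl | hb
      · exact htL haL
      · exact Finset.disjoint_left.1 hLB haL (hbB a hb)
  have hnd' : ((xs.zip bs).map Prod.fst ++ (xs.zip bs).map Prod.snd).Nodup := by
    refine hnd.sublist (List.Sublist.append ?_ ?_) <;>
      exact (List.sublist_cons_self _ _).map _
  obtain ⟨c, hc, hcP⟩ := exists_ladder_circuit κ _ hnd
  obtain ⟨d, hd, hdP⟩ := exists_ladder_circuit κ _ hnd'
  refine ⟨d ++ c, ?_, ?_⟩
  · simp only [cnotCount_append, List.length_cons, List.length_zip, hbsl, min_self] at hc hd ⊢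
    omega
  · convert hdP.append hcP using 1
    funext y
    have hcond : (∀ p ∈ ((x, t) :: xs.zip bs).map Prod.fst,
        ladderMap κ (xs.zip bs) y p = κ p) ↔ ∀ p ∈ L, y p = κ p := by
      rw [List.map_cons, hfst]
      constructor
      · intro h p hp
        rw [← h p ((hmem p).2 hp), ladderMap_apply_of_notMem]
        rw [hsnd]; exact fun h => Finset.disjoint_left.1 hLB hp (hbB p h)
      · intro h p hp
        rw [← h p ((hmem p).1 hp), ladderMap_apply_of_notMem]
        rw [hsnd]; exact fun h => Finset.disjoint_left.1 hLB ((hmem p).1 hp) (hbB p h)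
    have ht : ladderMap κ (xs.zip bs) y t = y t :=
      ladderMap_apply_of_notMem _ _ _ _ (by rw [hsnd]; exact fun h => htB (hbB t h))
    rw [Function.comp, ladderMap, hcond, ladderMap_involutive _ _ hnd', ht, flipIf]

/-- A multi-controlled NOT up to phases with a single borrowed bit `d`: four smaller ones, each of
which borrows the controls of the others. -/
theorem exists_mcx_circuit (κ : Bits n) (t d : Fin n) (L : Finset (Fin n))
    (htL : t ∉ L) (hdL : d ∉ L) (hdt : d ≠ t) :
    ∃ c : Circuit n, c.cnotCount ≤ 24 * L.card + 24 ∧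
      PermUpToPhase c (flipIf t fun y => ∀ p ∈ L, y p = κ p) := by
  classical
  rcases Nat.lt_or_ge L.card 2 with hL | hL
  · obtain ⟨c, hc, hP⟩ := exists_flipIf_circuit t L htL (fun y => ∀ p ∈ L, y p = κ p)
      (fun x y h => forall_congr' fun p => forall_congr' fun hp => by rw [h p hp])
    refine ⟨c, ?_, hP⟩
    have : 2 ^ L.card ≤ 2 ^ 1 := Nat.pow_le_pow_right (by norm_num) (by omega)
    omega
  · obtain ⟨L₁, hL₁, hcard⟩ := Finset.exists_subset_card_eq (s := L) (n := (L.card + 1) / 2)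
      (by omega)
    set L₂ := L \ L₁ with hL₂
    have hL₂L : L₂ ⊆ L := Finset.sdiff_subset
    have hcard₂ : L₂.card = L.card - L₁.card := Finset.card_sdiff_of_subset hL₁
    have hdisj : Disjoint L₁ L₂ := Finset.disjoint_sdiff
    have hd₁ : d ∉ L₁ := fun h => hdL (hL₁ h)
    have hd₂ : d ∉ L₂ := fun h => hdL (hL₂L h)
    have ht₁ : t ∉ L₁ := fun h => htL (hL₁ h)
    have ht₂ : t ∉ L₂ := fun h => htL (hL₂L h)
    -- `a` adds the condition on `L₁` to the borrowed bit `d`, and `b` adds `d` to `t` subject to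
    -- the condition on `L₂`; in `a b a b` the unknown initial value of `d` cancels.
    obtain ⟨a, ha, haP⟩ := exists_mcx_circuit_of_many_borrowed κ d L₁ (insert t L₂) hd₁
      (by simp [hdt, hd₂]) (by rw [Finset.disjoint_insert_right]; exact ⟨ht₁, hdisj⟩)
      (Finset.card_pos.1 (by omega)) (by rw [Finset.card_insert_of_notMem ht₂]; omega)
    obtain ⟨b, hb, hbP⟩ := exists_mcx_circuit_of_many_borrowed (Function.update κ d 1) t
      (insert d L₂) L₁ (by simp [hdt.symm, ht₂]) ht₁
      (by rw [Finset.disjoint_insert_left]; exact ⟨hd₁, hdisj.symm⟩)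
      (Finset.insert_nonempty _ _) (by rw [Finset.card_insert_of_notMem hd₂]; omega)
    refine ⟨a ++ (b ++ (a ++ b)), ?_, ?_⟩
    · rw [Finset.card_insert_of_notMem hd₂] at hb
      simp only [cnotCount_append]
      omega
    · convert haP.append (hbP.append (haP.append hbP)) using 1
      have hcond : ∀ y : Bits n, (∀ p ∈ insert d L₂, y p = Function.update κ d 1 p) ↔
          y d = 1 ∧ ∀ p ∈ L₂, y p = κ p := by
        intro y
        rw [Finset.forall_mem_insert, Function.update_self]
        refine and_congr_right fun _ => forall_congr' fun p => forall_congr' fun hp => ?_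
        rw [Function.update_of_ne (fun h : p = d => hd₂ (h ▸ hp))]
      have hL12 : ∀ y : Bits n, (∀ p ∈ L, y p = κ p) ↔
          (∀ p ∈ L₁, y p = κ p) ∧ ∀ p ∈ L₂, y p = κ p := by
        intro y
        constructor
        · exact fun h => ⟨fun p hp => h p (hL₁ hp), fun p hp => h p (hL₂L hp)⟩
        · rintro ⟨h1, h2⟩ p hp
          by_cases hp1 : p ∈ L₁
          · exact h1 p hp1
          · exact h2 p (Finset.mem_sdiff.2 ⟨hp, hp1⟩)
      have hup : ∀ (M : Finset (Fin n)) (s : Fin n) (y : Bits n) (v : Fin 2), s ∉ M →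
          ((∀ p ∈ M, Function.update y s v p = κ p) ↔ ∀ p ∈ M, y p = κ p) := by
        intro M s y v hs
        refine forall_congr' fun p => forall_congr' fun hp => ?_
        rw [Function.update_of_ne (fun h : p = s => hs (h ▸ hp))]
      funext y
      simp only [Function.comp, flipIf, hcond, hL12, hup L₁ d _ _ hd₁, hup L₁ t _ _ ht₁,
        hup L₂ d _ _ hd₂, hup L₂ t _ _ ht₂, Function.update_self, Function.update_of_ne hdt,
        Function.update_of_ne hdt.symm]
      funext p
      by_cases hpt : p = t
      · subst hpt
        simp only [Function.update_self]
        generalize (∀ q ∈ L₁, y q = κ q) = P₁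
        generalize (∀ q ∈ L₂, y q = κ q) = P₂
        by_cases h1 : P₁ <;> by_cases h2 : P₂ <;>
          rcases fin_two_cases (y d) with h | h <;>
          simp [h1, h2, h, add_assoc, indicatorBit]
      · by_cases hpd : p = d
        · subst hpd
          simp only [Function.update_self, Function.update_of_ne hpt]
          rw [add_assoc, fin_two_add_self, add_zero]
        · simp only [Function.update_of_ne hpt, Function.update_of_ne hpd]

/-! ### Two-level gates -/

/-- The matrix does not mix basis vectors with different values of bit `a`. -/
def PreservesBit (a : Fin n) (M : Matrix (Bits n) (Bits n) ℂ) : Prop :=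
  ∀ x y, x a ≠ y a → M x y = 0

/-- The matrix is diagonal at `y`: row and column `y` vanish off the diagonal. -/
def IsDiagAt (M : Matrix (Bits n) (Bits n) ℂ) (y : Bits n) : Prop :=
  ∀ x, x ≠ y → M x y = 0 ∧ M y x = 0

lemma PreservesBit.one (a : Fin n) : PreservesBit a (1 : Matrix (Bits n) (Bits n) ℂ) :=
  fun x y h => Matrix.one_apply_ne fun hxy => h (by rw [hxy])

lemma PreservesBit.mul {a : Fin n} {M N : Matrix (Bits n) (Bits n) ℂ} (hM : PreservesBit a M)
    (hN : PreservesBit a N) : PreservesBit a (M * N) := by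
  intro x y h
  rw [Matrix.mul_apply]
  refine Finset.sum_eq_zero fun z _ => ?_
  by_cases hz : x a = z a
  · rw [hN z y (hz ▸ h), mul_zero]
  · rw [hM x z hz, zero_mul]

lemma IsDiagAt.one (y : Bits n) : IsDiagAt (1 : Matrix (Bits n) (Bits n) ℂ) y :=
  fun _ h => ⟨Matrix.one_apply_ne h, Matrix.one_apply_ne h.symm⟩

lemma IsDiagAt.mul {y : Bits n} {M N : Matrix (Bits n) (Bits n) ℂ} (hM : IsDiagAt M y)
    (hN : IsDiagAt N y) : IsDiagAt (M * N) y := by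
  intro x h
  simp only [Matrix.mul_apply]
  constructor <;> refine Finset.sum_eq_zero fun z _ => ?_
  · by_cases hz : z = y
    · rw [hz, (hM x h).1, zero_mul]
    · rw [(hN z hz).1, mul_zero]
  · by_cases hz : z = y
    · rw [hz, (hN x h).2, mul_zero]
    · rw [(hM z hz).2, zero_mul]

lemma IsDiagAt.mulVec {y : Bits n} {M : Matrix (Bits n) (Bits n) ℂ} (hM : IsDiagAt M y)
    (ψ : Bits n → ℂ) : (M *ᵥ ψ) y = M y y * ψ y := by
  rw [Matrix.mulVec, dotProduct, Finset.sum_eq_single y]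
  · intro z _ hz; rw [(hM z hz).2, zero_mul]
  · simp

lemma PreservesBit.mulVec_eq_zero {a : Fin n} {M : Matrix (Bits n) (Bits n) ℂ}
    (hM : PreservesBit a M) {ψ : Bits n → ℂ} {b : Fin 2} (hψ : ∀ y, ψ y ≠ 0 → y a = b) {x : Bits n}
    (hx : x a ≠ b) : (M *ᵥ ψ) x = 0 := by
  rw [Matrix.mulVec, dotProduct]
  refine Finset.sum_eq_zero fun z _ => ?_
  by_cases hz : ψ z = 0
  · rw [hz, mul_zero]
  · rw [hM x z (by rw [hψ z hz]; exact hx), zero_mul]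

lemma PreservesBit.diagonal_mul_mux {a q : Fin n} (haq : a ≠ q) (D : Bits n → ℂ)
    (R : Bits n → Matrix (Fin 2) (Fin 2) ℂ) : PreservesBit a (Matrix.diagonal D * mux q R) := by
  intro x y h
  rw [Matrix.diagonal_mul, mux, Matrix.of_apply, if_neg, mul_zero]
  exact fun h' => h (h' a haq)

lemma IsDiagAt.diagonal_mul_mux {q : Fin n} (D : Bits n → ℂ)
    {R : Bits n → Matrix (Fin 2) (Fin 2) ℂ} {y : Bits n}
    (hR : ∀ b, R (Function.update y q b) = 1) : IsDiagAt (Matrix.diagonal D * mux q R) y := by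
  intro x hxy
  have key : ∀ z w : Bits n, z ≠ w → (∃ b, z = Function.update y q b) →
      (Matrix.diagonal D * mux q R) z w = 0 := by
    rintro z w hzw ⟨b, rfl⟩
    rw [Matrix.diagonal_mul, mux, Matrix.of_apply, hR]
    split_ifs with h
    · rw [Matrix.one_apply_ne, mul_zero]
      intro hq
      refine hzw (funext fun p => ?_)
      by_cases hp : p = q
      · rw [hp]; exact hq
      · exact h p hp
    · rw [mul_zero]
  refine ⟨?_, key y x hxy.symm ⟨y q, (Function.update_eq_self _ _).symm⟩⟩
  by_cases h : ∀ p, p ≠ q → y p = x p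
  · exact key x y hxy ⟨x q, (agree_off_iff q y x).1 h⟩
  · rw [Matrix.diagonal_mul, mux, Matrix.of_apply, if_neg, mul_zero]
    exact fun h' => h fun p hp => (h' p hp).symm

/-- A single-qubit unitary that annihilates a prescribed component of a vector. -/
lemma exists_unitary_component_eq_zero (z : Fin 2 → ℂ) (b : Fin 2) :
    ∃ u ∈ Matrix.unitaryGroup (Fin 2) ℂ, ∑ i, u b i * z i = 0 := by
  suffices h : ∃ u ∈ Matrix.unitaryGroup (Fin 2) ℂ, ∑ i, u 1 i * z i = 0 by
    rcases fin_two_cases b with rfl | rfl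
    · obtain ⟨u, hu, h⟩ := h
      refine ⟨pauliX * u, mul_mem pauliX_mem hu, ?_⟩
      simpa [pauliX, Matrix.mul_apply, Fin.sum_univ_two] using h
    · exact h
  by_cases hz : z = 0
  · exact ⟨1, one_mem _, by simp [hz]⟩
  have hpos : 0 < ‖z 0‖ ^ 2 + ‖z 1‖ ^ 2 := by
    by_contra hneg
    have h0 : ‖z 0‖ = 0 := by nlinarith [sq_nonneg ‖z 0‖, sq_nonneg ‖z 1‖]
    have h1 : ‖z 1‖ = 0 := by nlinarith [sq_nonneg ‖z 0‖, sq_nonneg ‖z 1‖]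
    refine hz (funext fun i => ?_)
    fin_cases i
    · simpa using h0
    · simpa using h1
  set t : ℂ := ((Real.sqrt (‖z 0‖ ^ 2 + ‖z 1‖ ^ 2) : ℝ) : ℂ)⁻¹ with ht
  have hcast : ((‖z 0‖ ^ 2 + ‖z 1‖ ^ 2 : ℝ) : ℂ) =
      z 0 * (starRingEnd ℂ) (z 0) + z 1 * (starRingEnd ℂ) (z 1) := by
    rw [Complex.mul_conj', Complex.mul_conj']; push_cast; rfl
  have hne : z 0 * (starRingEnd ℂ) (z 0) + z 1 * (starRingEnd ℂ) (z 1) ≠ 0 := by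
    rw [← hcast]; exact_mod_cast hpos.ne'
  have htt : t * t = (z 0 * (starRingEnd ℂ) (z 0) + z 1 * (starRingEnd ℂ) (z 1))⁻¹ := by
    rw [ht, ← mul_inv, ← Complex.ofReal_mul, Real.mul_self_sqrt hpos.le, hcast]
  set M : Matrix (Fin 2) (Fin 2) ℂ :=
    !![(starRingEnd ℂ) (z 0), (starRingEnd ℂ) (z 1); -z 1, z 0] with hM
  have hMd : Mᴴ = !![z 0, -(starRingEnd ℂ) (z 1); z 1, (starRingEnd ℂ) (z 0)] := by
    ext i j; fin_cases i <;> fin_cases j <;> simp [hM]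
  have hMM : (t • M)ᴴ = t • Mᴴ := by
    rw [Matrix.conjTranspose_smul, ht, star_inv₀, Complex.star_def, Complex.conj_ofReal]
  refine ⟨t • M, ?_, ?_⟩
  · rw [Matrix.mem_unitaryGroup_iff, Matrix.star_eq_conjTranspose, hMM, Matrix.smul_mul,
      Matrix.mul_smul, smul_smul, htt, inv_smul_eq_iff₀ hne, hMd, hM]
    ext i j
    fin_cases i <;> fin_cases j <;> simp [Matrix.mul_apply, Fin.sum_univ_two] <;> ring
  · simp [hM, Fin.sum_univ_two]; ring

lemma flipIf_involutive {t : Fin n} {P : Bits n → Prop}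
    (hP : ∀ y b, P (Function.update y t b) ↔ P y) (y : Bits n) :
    flipIf t P (flipIf t P y) = y := by
  rw [flipIf, show P (flipIf t P y) = P y from propext (hP _ _), flipIf, Function.update_self,
    Function.update_idem, add_assoc, fin_two_add_self, add_zero, Function.update_eq_self]

lemma fin_two_eq_add_one : ∀ {b c : Fin 2}, b ≠ c → b = c + 1 := by decide

/-- Conjugating with a permutation up to phases. -/
lemma conj_perm_apply {c d : Circuit n} {π : Bits n → Bits n} {φ : Bits n → ℂ}
    (hc : ∀ x y, c.toMatrix x y = if x = π y then φ y else 0) (x y : Bits n) :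
    Circuit.toMatrix (c ++ (d ++ Circuit.inv c)) x y =
      (starRingEnd ℂ) (φ x) * Circuit.toMatrix d (π x) (π y) * φ y := by
  rw [toMatrix_append, toMatrix_append, Circuit.toMatrix_inv, Matrix.mul_apply]
  simp only [hc, mul_ite, mul_zero, Finset.sum_ite_eq', Finset.mem_univ, if_true]
  rw [Matrix.mul_apply]
  simp only [Matrix.conjTranspose_apply, hc]
  simp [apply_ite, ite_mul]

/-- The circuit that computes into bit `a` whether all bits except `a` and `s` agree with `k`. -/
lemma exists_indicator_circuit (a s : Fin n) (has : a ≠ s) (k : Bits n) :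
    ∃ (c : Circuit n) (φ : Bits n → ℂ), c.cnotCount ≤ 24 * n + 24 ∧ (∀ y, ‖φ y‖ = 1) ∧
      ∀ x y, c.toMatrix x y =
        if x = flipIf a (fun y => ∀ p, p ≠ a → p ≠ s → y p = k p) y then φ y else 0 := by
  obtain ⟨c, hc, φ, hφ, hM⟩ := exists_mcx_circuit k a s (Finset.univ \ {a, s}) (by simp)
    (by simp) has.symm
  refine ⟨c, φ, ?_, hφ, ?_⟩
  · have := Finset.card_le_univ (Finset.univ \ {a, s} : Finset (Fin n))
    rw [Fintype.card_fin] at this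
    omega
  · simpa using hM

lemma flipIf_off_apply_ne {a : Fin n} {P : Bits n → Prop} {y : Bits n} {p : Fin n} (h : p ≠ a) :
    flipIf a P y p = y p := by rw [flipIf, Function.update_of_ne h]

/-- A fully controlled single-qubit gate on qubit `s` that moves the amplitude of a given vector at
`k` with bit `s` flipped onto `k`, and acts diagonally, up to phases, on all other basis vectors
with clean ancilla `a`. -/
lemma exists_two_level_circuit (a s : Fin n) (has : a ≠ s) (k : Bits n) (hk : k a = 0)
    (ψ : Bits n → ℂ) :
    ∃ c : Circuit n, c.cnotCount ≤ 48 * n + 49 ∧ PreservesBit a c.toMatrix ∧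
      (∀ y : Bits n, y a = 0 → y ≠ k → y ≠ Function.update k s (k s + 1) →
        IsDiagAt c.toMatrix y) ∧
      (c.toMatrix *ᵥ ψ) (Function.update k s (k s + 1)) = 0 := by
  classical
  obtain ⟨A, φ, hA, hφ, hAM⟩ := exists_indicator_circuit a s has k
  set P : Bits n → Prop := fun y => ∀ p, p ≠ a → p ≠ s → y p = k p with hP
  set π := flipIf a P with hπ
  -- The phases `φ` of the indicator circuit enter before `u` acts, hence their presence here.
  obtain ⟨u, hu, hu0⟩ := exists_unitary_component_eq_zero
    (fun b => φ (Function.update k s b) * ψ (Function.update k s b)) (k s + 1)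
  obtain ⟨d, D, hd, hD, -, hdM⟩ := exists_mux_circuit s {a} (by simpa using has.symm)
    (fun x => if x a = 1 then u else 1)
    (fun x => by
      split_ifs
      · exact hu
      · exact one_mem _)
    (fun x y h => by simp only [h a (by simp)])
  have hπs : ∀ y, π y s = y s := fun y => flipIf_off_apply_ne has.symm
  -- Nonzero entries connect only strings that agree off `s`, and only equal ones unless all their
  -- other system bits agree with those of `k`.
  have hent : ∀ x y, Circuit.toMatrix (A ++ (d ++ Circuit.inv A)) x y ≠ 0 →
      (∀ p, p ≠ s → x p = y p) ∧ (P x ↔ P y) ∧ (¬ P x → x a = 0 → x = y) := by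
    intro x y hxy
    rw [conj_perm_apply hAM, hdM, Matrix.diagonal_mul, mux, Matrix.of_apply] at hxy
    by_cases h : ∀ p, p ≠ s → π x p = π y p
    · rw [if_pos h] at hxy
      have h1 : ∀ p, p ≠ a → p ≠ s → x p = y p := by
        intro p hpa hps
        have := h p hps
        rwa [hπ, flipIf_off_apply_ne hpa, flipIf_off_apply_ne hpa] at this
      have h2 : P x ↔ P y := forall_congr' fun p => forall_congr' fun hpa =>
        forall_congr' fun hps => by rw [h1 p hpa hps]
      have h3 : x a = y a := by
        have := h a has
        simp only [hπ, flipIf, Function.update_self, h2] at this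
        exact add_right_cancel this
      have h4 : ∀ p, p ≠ s → x p = y p := by
        intro p hps
        by_cases hpa : p = a
        · rw [hpa, h3]
        · exact h1 p hpa hps
      refine ⟨h4, h2, fun hPx hxa => ?_⟩
      have h5 : π x a = 0 := by
        rw [hπ, flipIf, Function.update_self, indicatorBit_of_false hPx, hxa, add_zero]
      rw [h5, if_neg (by decide), hπs, hπs] at hxy
      have hs : x s = y s := by
        by_contra hs
        simp [Matrix.one_apply_ne hs] at hxy
      funext p
      by_cases hps : p = s
      · rw [hps, hs]
      · exact h4 p hps
    · simp [if_neg h] at hxy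
  have hPeq : ∀ y : Bits n, y a = 0 → P y → y = k ∨ y = Function.update k s (k s + 1) := by
    intro y hya hPy
    have : y = Function.update k s (y s) := by
      refine (agree_off_iff s k y).1 fun p hps => ?_
      by_cases hpa : p = a
      · rw [hpa, hya, hk]
      · exact (hPy p hpa hps).symm
    by_cases hs : y s = k s
    · left; rw [this, hs, Function.update_eq_self]
    · right
      rw [← fin_two_eq_add_one hs]; exact this
  refine ⟨A ++ (d ++ Circuit.inv A), ?_, ?_, ?_, ?_⟩
  · rw [cnotCount_append, cnotCount_append, Circuit.cnotCount_inv]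
    simp only [Finset.card_singleton] at hd
    omega
  · intro x y hxy
    by_contra h
    exact hxy ((hent x y h).1 a has)
  · intro y hya hyk hyk' x hxy
    have hPy : ¬ P y := fun h => (hPeq y hya h).elim hyk hyk'
    refine ⟨?_, ?_⟩ <;> by_contra h
    · obtain ⟨h1, h2, h3⟩ := hent x y h
      exact hxy (h3 (fun h => hPy (h2.1 h)) (by rw [h1 a has, hya]))
    · obtain ⟨h1, h2, h3⟩ := hent y x h
      exact hxy (h3 hPy hya).symm
  · set k' := Function.update k s (k s + 1) with hk'
    have hPu : ∀ b, P (Function.update k s b) := fun b p _ hps => by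
      rw [Function.update_of_ne hps]
    have hrow : ∀ y, Circuit.toMatrix (A ++ (d ++ Circuit.inv A)) k' y * ψ y =
        if ∀ p, p ≠ s → k' p = y p then
          (starRingEnd ℂ) (φ k') * D (π k') * (u (k s + 1) (y s) * (φ y * ψ y)) else 0 := by
      intro y
      split_ifs with h
      · rw [conj_perm_apply hAM, hdM, Matrix.diagonal_mul, mux, Matrix.of_apply]
        have hy : y = Function.update k s (y s) := by
          rw [(agree_off_iff s k' y).1 h, hk', Function.update_idem, Function.update_self]
        have hPy : P y := by rw [hy]; exact hPu _
        have hagree : ∀ p, p ≠ s → π k' p = π y p := by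
          intro p hps
          by_cases hpa : p = a
          · subst hpa
            simp only [hπ, flipIf, Function.update_self, indicatorBit_of_true hPy,
              indicatorBit_of_true (hPu _), hk']
            rw [← h p hps, hk']
          · rw [hπ, flipIf_off_apply_ne hpa, flipIf_off_apply_ne hpa, h p hps]
        have hone : π k' a = 1 := by
          rw [hπ, flipIf, Function.update_self, indicatorBit_of_true (hPu _), hk',
            Function.update_of_ne has, hk, zero_add]
        rw [if_pos hagree, if_pos hone, hπs, hπs, hk', Function.update_self]
        ring
      · have : Circuit.toMatrix (A ++ (d ++ Circuit.inv A)) k' y = 0 := by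
          by_contra h'
          exact h (hent k' y h').1
        rw [this, zero_mul]
    rw [Matrix.mulVec, dotProduct, Finset.sum_congr rfl fun y _ => hrow y, sum_agree_off]
    simp only [hk', Function.update_idem, Function.update_self]
    rw [← Finset.mul_sum, hu0, mul_zero]

/-! ### Isometries, column by column -/

lemma toLex_lt_iff (x y : Bits n) :
    toLex x < toLex y ↔ ∃ p, (∀ q < p, x q = y q) ∧ x p < y p := Iff.rfl

lemma exists_first_difference {x y : Bits n} (hxy : x ≠ y) (h : ¬ toLex x < toLex y) :
    ∃ p, (∀ q < p, y q = x q) ∧ y p < x p :=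
  (toLex_lt_iff y x).1 ((not_lt.1 h).lt_of_ne fun h' => hxy (toLex.injective h').symm)

/-- One stage of the elimination of a column. If the bits after `s` have the values of `k` already,
the amplitudes are moved to strings whose bit `s` has the value of `k` as well, with the exception
of `k` with bit `s` flipped. The multiplexed gate acts trivially unless the bits before `s` are
lexicographically greater than those of `k`, so that strings preceding `k` are not affected. -/
lemma exists_sweep_circuit (a s : Fin n) (ha : (a : ℕ) = 0) (has : a < s) (k : Bits n)
    (hk : k a = 0) (ψ : Bits n → ℂ)
    (hψ : ∀ y, ψ y ≠ 0 → y a = 0 ∧ ¬ toLex y < toLex k ∧ ∀ p, s < p → y p = k p) :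
    ∃ c : Circuit n, c.cnotCount + 1 ≤ 2 ^ (s - 1 : ℕ) ∧ PreservesBit a c.toMatrix ∧
      (∀ y : Bits n, y a = 0 → toLex y < toLex k → IsDiagAt c.toMatrix y) ∧
      ∀ y, (c.toMatrix *ᵥ ψ) y ≠ 0 → y a = 0 ∧ ¬ toLex y < toLex k ∧
        ((∀ p, s ≤ p → y p = k p) ∨ (k s = 0 ∧ y = Function.update k s (k s + 1))) := by
  classical
  set L : Finset (Fin n) := Finset.Ioo a s with hL
  have hsL : s ∉ L := by simp [hL]
  have ha0 : ∀ p : Fin n, p ≠ a → a < p := by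
    intro p hp
    rw [Fin.lt_def, ha]
    have : (p : ℕ) ≠ a := fun h => hp (Fin.ext h)
    omega
  -- `G x`: the system bits of `x` before `s` are greater than those of `k`.
  let G : Bits n → Prop := fun x => ∃ p ∈ L, (∀ q ∈ L, q < p → k q = x q) ∧ k p < x p
  let rep : Bits n → Bits n := fun x p => if p ∈ L then x p else k p
  have hGL : ∀ x y : Bits n, (∀ p ∈ L, x p = y p) → (G x ↔ G y) := by
    intro x y h
    refine exists_congr fun p => and_congr_right fun hp => ?_
    rw [h p hp]
    refine and_congr_left fun _ => forall_congr' fun q => forall_congr' fun hq => ?_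
    rw [h q hq]
  have hrepL : ∀ x y : Bits n, (∀ p ∈ L, x p = y p) → rep x = rep y := by
    intro x y h; funext p
    by_cases hp : p ∈ L
    · simp [rep, hp, h p hp]
    · simp [rep, hp]
  choose u hu hu0 using fun x : Bits n =>
    exists_unitary_component_eq_zero (fun b => ψ (Function.update (rep x) s b)) (k s + 1)
  obtain ⟨c, D, hc, hD, -, hM⟩ := exists_mux_circuit s L hsL (fun x => if G x then u (rep x) else 1)
    (fun x => by
      split_ifs
      · exact hu _
      · exact one_mem _)
    (fun x y h => by simp only [hGL x y h, hrepL x y h])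
  have hGlt : ∀ x : Bits n, x a = 0 → G x → toLex k < toLex x := by
    rintro x hxa ⟨p, hp, hlt, hkp⟩
    refine ⟨p, fun q hq => ?_, hkp⟩
    by_cases hqa : q = a
    · subst hqa
      exact hk.trans hxa.symm
    · exact hlt q (Finset.mem_Ioo.2 ⟨ha0 q hqa, hq.trans (Finset.mem_Ioo.1 hp).2⟩) hq
  have hoff : ∀ (x : Bits n) (b : Fin 2), ∀ p ∈ L, Function.update x s b p = x p := by
    intro x b p hp
    rw [Function.update_of_ne fun h : p = s => hsL (h ▸ hp)]
  have hfin : ∀ x : Bits n, (c.toMatrix *ᵥ ψ) x =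
      D x * ∑ b, (if G x then u (rep x) else 1) (x s) b * ψ (Function.update x s b) := by
    intro x
    rw [hM, ← Matrix.mulVec_mulVec, Matrix.mulVec_diagonal, mux_mulVec]
  refine ⟨c, ?_, ?_, ?_, ?_⟩
  · rw [hL, Fin.card_Ioo, ha] at hc
    exact hc
  · rw [hM]; exact PreservesBit.diagonal_mul_mux has.ne _ _
  · intro y hya hyk
    rw [hM]
    refine IsDiagAt.diagonal_mul_mux _ fun b => if_neg ?_
    rw [hGL _ _ (hoff y b)]
    exact fun hG => lt_asymm hyk (hGlt y hya hG)
  · intro x hx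
    rw [hfin] at hx
    by_cases hG : G x
    · simp only [if_pos hG] at hx
      obtain ⟨b, -, hb⟩ := Finset.exists_ne_zero_of_sum_ne_zero (right_ne_zero_of_mul hx)
      obtain ⟨h1, h2, h3⟩ := hψ _ (right_ne_zero_of_mul hb)
      rw [Function.update_of_ne has.ne] at h1
      have h3' : ∀ p, s < p → x p = k p := fun p hp => by
        have := h3 p hp
        rwa [Function.update_of_ne hp.ne'] at this
      have hrep : ∀ b, Function.update (rep x) s b = Function.update x s b := by
        intro b; funext p
        by_cases hps : p = s
        · subst hps; simp
        · rw [Function.update_of_ne hps, Function.update_of_ne hps]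
          by_cases hp : p ∈ L
          · simp [rep, hp]
          · simp only [rep, hp, if_false]
            by_cases hpa : p = a
            · rw [hpa, h1, hk]
            · have : s < p := by
                by_contra hsp
                exact hp (Finset.mem_Ioo.2 ⟨ha0 p hpa, (not_lt.1 hsp).lt_of_ne hps⟩)
              rw [h3' p this]
      have hrr : rep (rep x) = rep x := hrepL _ _ fun p hp => by simp [rep, hp]
      have hxs : x s = k s := by
        by_contra hxs
        apply hx
        rw [fin_two_eq_add_one hxs]
        have := hu0 (rep x)
        simp only [hrr, hrep] at this
        rw [this, mul_zero]
      refine ⟨h1, lt_asymm (hGlt x h1 hG), Or.inl fun p hp => ?_⟩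
      rcases hp.eq_or_lt with rfl | hp
      · exact hxs
      · exact h3' p hp
    · simp only [if_neg hG] at hx
      rw [Finset.sum_eq_single (x s) (fun b _ hb => by rw [Matrix.one_apply_ne hb.symm, zero_mul])
        (by simp), Matrix.one_apply_eq, one_mul, Function.update_eq_self] at hx
      obtain ⟨h1, h2, h3⟩ := hψ _ (right_ne_zero_of_mul hx)
      refine ⟨h1, h2, ?_⟩
      by_cases hxs : x s = k s
      · left
        intro p hp
        rcases hp.eq_or_lt with rfl | hp
        · exact hxs
        · exact h3 p hp
      · right
        -- The first difference with `k` is an excess, and `¬ G x` leaves only position `s` for it.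
        obtain ⟨p, hp, hkp⟩ := exists_first_difference (fun h => hxs (by rw [h])) h2
        have hpa : p ≠ a := by
          rintro rfl
          rw [h1, hk] at hkp
          exact lt_irrefl _ hkp
        have hps : p = s := by
          rcases lt_trichotomy p s with h | h | h
          · exact absurd ⟨p, Finset.mem_Ioo.2 ⟨ha0 p hpa, h⟩, fun q _ hq => hp q hq, hkp⟩ hG
          · exact h
          · exact absurd (hp s h).symm hxs
        subst hps
        have hk0 : k p = 0 := by
          rcases fin_two_cases (k p) with h | h
          · exact h
          · rw [h] at hkp; exact absurd hkp (by have := Fin.le_last (x p); exact not_lt.2 this)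
        refine ⟨hk0, ?_⟩
        rw [← fin_two_eq_add_one hxs]
        refine (agree_off_iff p k x).1 fun q hq => ?_
        rcases lt_or_gt_of_ne hq with h | h
        · exact hp q h
        · exact (h3 q h).symm

/-- A vector with clean ancilla that vanishes at all basis vectors preceding `k` is mapped to a
multiple of `|k⟩`, while the basis vectors preceding `k` are preserved up to phases. The bits above
position `j` are assumed to have their final values already. -/
lemma exists_column_circuit_aux (a : Fin n) (ha : (a : ℕ) = 0) (k : Bits n) (hk : k a = 0) (j : ℕ)
    (hj : j < n) : ∀ ψ : Bits n → ℂ,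
    (∀ y, ψ y ≠ 0 → y a = 0 ∧ ¬ toLex y < toLex k ∧ ∀ p : Fin n, j < p → y p = k p) →
    ∃ c : Circuit n, c.cnotCount + 1 ≤ 2 ^ j + j * (48 * n + 49) ∧ PreservesBit a c.toMatrix ∧
      (∀ y : Bits n, y a = 0 → toLex y < toLex k → IsDiagAt c.toMatrix y) ∧
      ∀ y, y ≠ k → (c.toMatrix *ᵥ ψ) y = 0 := by
  induction j with
  | zero =>
    intro ψ hψ
    refine ⟨[], by simp [Circuit.cnotCount], PreservesBit.one a, fun y _ _ => IsDiagAt.one y, ?_⟩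
    intro y hy
    rw [Circuit.toMatrix, Matrix.one_mulVec]
    by_contra h
    obtain ⟨h1, -, h3⟩ := hψ y h
    refine hy (funext fun p => ?_)
    by_cases hp : p = a
    · rw [hp, h1, hk]
    · refine h3 p (Nat.pos_of_ne_zero fun h => hp (Fin.ext (h.trans ha.symm)))
  | succ j ih =>
    intro ψ hψ
    set s : Fin n := ⟨j + 1, hj⟩ with hs
    have has : a < s := by rw [Fin.lt_def, ha]; exact Nat.succ_pos j
    obtain ⟨c₁, hc₁, hp₁, hd₁, hw₁⟩ := exists_sweep_circuit a s ha has k hk ψ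
      (fun y hy => hψ y hy)
    set k' := Function.update k s (k s + 1) with hk'
    obtain ⟨c₂, hc₂, hp₂, hd₂, hw₂⟩ : ∃ c : Circuit n, c.cnotCount ≤ 48 * n + 49 ∧
        PreservesBit a c.toMatrix ∧
        (∀ y : Bits n, y a = 0 → toLex y < toLex k → IsDiagAt c.toMatrix y) ∧
        ∀ y, (c.toMatrix *ᵥ (c₁.toMatrix *ᵥ ψ)) y ≠ 0 →
          y a = 0 ∧ ¬ toLex y < toLex k ∧ ∀ p, s ≤ p → y p = k p := by
      rcases fin_two_cases (k s) with hks | hks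
      · obtain ⟨c, hc, hp, hd, hw⟩ := exists_two_level_circuit a s has.ne k hk (c₁.toMatrix *ᵥ ψ)
        have hkk' : toLex k < toLex k' := by
          refine ⟨s, fun q hq => ?_, ?_⟩
          · exact (Function.update_of_ne hq.ne _ _).symm
          · change k s < k' s
            rw [hk', Function.update_self, hks]; decide
        refine ⟨c, hc, hp, fun y hya hyk => hd y hya ?_ ?_, ?_⟩
        · rintro rfl; exact lt_irrefl _ hyk
        · intro h; rw [h] at hyk; exact lt_asymm hyk hkk'
        · intro y hy
          have hya : y a = 0 := by
            by_contra h
            exact hy (hp.mulVec_eq_zero (fun z hz => (hw₁ z hz).1) h)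
          by_cases hyk : y = k
          · subst hyk; exact ⟨hya, lt_irrefl _, fun _ _ => rfl⟩
          by_cases hyk' : y = k'
          · subst hyk'; exact absurd hw hy
          rw [(hd y hya hyk hyk').mulVec] at hy
          obtain ⟨h1, h2, h3⟩ := hw₁ y (right_ne_zero_of_mul hy)
          exact ⟨h1, h2, h3.resolve_right fun h => hyk' h.2⟩
      · refine ⟨[], by simp [Circuit.cnotCount], PreservesBit.one a, fun y _ _ => IsDiagAt.one y,
          fun y hy => ?_⟩
        rw [Circuit.toMatrix, Matrix.one_mulVec] at hy
        obtain ⟨h1, h2, h3⟩ := hw₁ y hy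
        exact ⟨h1, h2, h3.resolve_right fun h => by rw [hks] at h; exact absurd h.1 (by decide)⟩
    obtain ⟨c₃, hc₃, hp₃, hd₃, hw₃⟩ := ih (by omega) (c₂.toMatrix *ᵥ (c₁.toMatrix *ᵥ ψ))
      (fun y hy => ⟨(hw₂ y hy).1, (hw₂ y hy).2.1, fun p hp => (hw₂ y hy).2.2 p hp⟩)
    refine ⟨c₁ ++ (c₂ ++ c₃), ?_, ?_, ?_, ?_⟩
    · simp only [hs, Nat.add_sub_cancel] at hc₁
      rw [cnotCount_append, cnotCount_append, pow_succ, Nat.succ_mul]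
      omega
    · rw [toMatrix_append, toMatrix_append]
      exact (hp₃.mul hp₂).mul hp₁
    · intro y hya hyk
      rw [toMatrix_append, toMatrix_append]
      exact ((hd₃ y hya hyk).mul (hd₂ y hya hyk)).mul (hd₁ y hya hyk)
    · intro y hy
      rw [toMatrix_append, toMatrix_append, ← Matrix.mulVec_mulVec, ← Matrix.mulVec_mulVec]
      exact hw₃ y hy

lemma star_mulVec_dotProduct_mulVec (c : Circuit n) (v w : Bits n → ℂ) :
    star (c.toMatrix *ᵥ v) ⬝ᵥ (c.toMatrix *ᵥ w) = star v ⬝ᵥ w := by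
  rw [Matrix.star_mulVec, ← Matrix.dotProduct_mulVec, Matrix.mulVec_mulVec,
    Circuit.conjTranspose_mul_self, Matrix.one_mulVec]

lemma eq_single_of_forall_ne {k : Bits n} {w : Bits n → ℂ} (h : ∀ y, y ≠ k → w y = 0) :
    w = Pi.single k (w k) := by
  funext y
  by_cases hy : y = k
  · subst hy; simp
  · rw [h y hy, Pi.single_eq_of_ne hy]

lemma norm_eq_one_of_dotProduct {k : Bits n} {z : ℂ}
    (h : star (Pi.single k z : Bits n → ℂ) ⬝ᵥ Pi.single k z = 1) : ‖z‖ = 1 := by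
  rw [dotProduct_single, Pi.star_apply, Pi.single_eq_same, mul_comm] at h
  have h' : z * (starRingEnd ℂ) z = 1 := h
  rw [Complex.mul_conj'] at h'
  have h2 : ‖z‖ ^ 2 = 1 := by exact_mod_cast h'
  exact (pow_eq_one_iff_of_nonneg (norm_nonneg _) (by norm_num)).1 h2

/-- Orthonormal vectors with clean ancilla are mapped, up to phases, to the first basis vectors in
lexicographic order, one column after the other. -/
theorem exists_isometry_circuit (a : Fin n) (ha : (a : ℕ) = 0) {K : ℕ} (e : Fin K → Bits n)
    (hea : ∀ i, e i a = 0)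
    (he : ∀ i y, y a = 0 → toLex y < toLex (e i) → ∃ i' < i, y = e i')
    (he' : ∀ i i', i < i' → toLex (e i) < toLex (e i'))
    (v : Fin K → Bits n → ℂ) (hva : ∀ i y, v i y ≠ 0 → y a = 0)
    (hv : ∀ i j, star (v i) ⬝ᵥ v j = if i = j then 1 else 0) :
    ∃ (c : Circuit n) (φ : Fin K → ℂ), c.cnotCount ≤ K * (2 ^ (n - 1) + n * (48 * n + 49)) ∧
      PreservesBit a c.toMatrix ∧ (∀ i, ‖φ i‖ = 1) ∧
      ∀ i, c.toMatrix *ᵥ v i = Pi.single (e i) (φ i) := by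
  suffices h : ∀ l ≤ K, ∃ c : Circuit n, c.cnotCount ≤ l * (2 ^ (n - 1) + n * (48 * n + 49)) ∧
      PreservesBit a c.toMatrix ∧ ∀ i : Fin K, (i : ℕ) < l → ∀ y, y ≠ e i →
        (c.toMatrix *ᵥ v i) y = 0 by
    obtain ⟨c, hc, hp, hw⟩ := h K le_rfl
    have hw' := fun i => eq_single_of_forall_ne (hw i i.2)
    refine ⟨c, fun i => (c.toMatrix *ᵥ v i) (e i), hc, hp, fun i => ?_, hw'⟩
    apply norm_eq_one_of_dotProduct (k := e i)
    rw [← hw' i, star_mulVec_dotProduct_mulVec, hv, if_pos rfl]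
  intro l
  induction l with
  | zero =>
    intro _
    exact ⟨[], by simp [Circuit.cnotCount], PreservesBit.one a, fun i hi => absurd hi (by simp)⟩
  | succ l ih =>
    intro hl
    obtain ⟨c, hc, hp, hw⟩ := ih (by omega)
    set i₀ : Fin K := ⟨l, hl⟩ with hi₀
    have hn : n ≠ 0 := by rintro rfl; exact a.elim0
    obtain ⟨d, hd, hdp, hdd, hdw⟩ := exists_column_circuit_aux a ha (e i₀) (hea i₀) (n - 1)
      (by omega) (c.toMatrix *ᵥ v i₀) (by
        intro y hy
        refine ⟨?_, ?_, fun p hp => absurd p.2 (by omega)⟩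
        · by_contra h
          exact hy (hp.mulVec_eq_zero (hva i₀) h)
        · intro hlt
          have hya : y a = 0 := by
            by_contra h
            exact hy (hp.mulVec_eq_zero (hva i₀) h)
          obtain ⟨i, hi, rfl⟩ := he i₀ y hya hlt
          have h1 := eq_single_of_forall_ne (hw i hi)
          have h2 := star_mulVec_dotProduct_mulVec c (v i) (v i₀)
          have h3 := star_mulVec_dotProduct_mulVec c (v i) (v i)
          rw [hv, if_pos rfl, h1] at h3
          have h4 := norm_eq_one_of_dotProduct h3
          rw [hv, if_neg hi.ne, h1, ← Pi.single_star, single_dotProduct] at h2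
          rcases mul_eq_zero.1 h2 with h5 | h5
          · rw [star_eq_zero] at h5
            rw [h5, norm_zero] at h4
            exact zero_ne_one h4
          · exact hy h5)
    refine ⟨c ++ d, ?_, ?_, ?_⟩
    · rw [cnotCount_append, Nat.succ_mul]
      have : (n - 1) * (48 * n + 49) ≤ n * (48 * n + 49) := Nat.mul_le_mul_right _ (by omega)
      omega
    · rw [toMatrix_append]; exact hdp.mul hp
    · intro i hi y hy
      rw [toMatrix_append, ← Matrix.mulVec_mulVec]
      rcases Nat.lt_succ_iff_lt_or_eq.1 hi with h | h
      · rw [eq_single_of_forall_ne (hw i h), Matrix.mulVec_single]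
        have := hdd (e i) (hea i) (he' i i₀ h) y hy
        simp [this.1]
      · have : i = i₀ := Fin.ext h
        rw [this] at hy ⊢
        exact hdw y hy

/-! ### Exact phases at basis vectors -/

lemma single_diagonal_toMatrix (q : Fin n) (r : Fin 2 → ℂ) (hr : ∀ b, ‖r b‖ = 1) :
    (Gate.single q ⟨_, diagonal_mem_unitaryGroup hr⟩).toMatrix =
      Matrix.diagonal fun x : Bits n => r (x q) := by
  rw [single_toMatrix]
  have := diagonal_mul_mux q (fun _ : Bits n => (1 : Matrix (Fin 2) (Fin 2) ℂ)) (fun _ => r)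
  simpa [mux_one] using this

lemma conj_perm_diagonal {c d : Circuit n} {π : Bits n → Bits n} {φ : Bits n → ℂ}
    (hc : ∀ x y, c.toMatrix x y = if x = π y then φ y else 0) (hπ : ∀ y, π (π y) = y)
    (hφ : ∀ y, ‖φ y‖ = 1) {β : Bits n → ℂ} (hd : d.toMatrix = Matrix.diagonal β) :
    Circuit.toMatrix (c ++ (d ++ Circuit.inv c)) = Matrix.diagonal fun x => β (π x) := by
  ext x y
  rw [conj_perm_apply hc, hd]
  by_cases hxy : x = y
  · subst hxy
    rw [Matrix.diagonal_apply_eq, Matrix.diagonal_apply_eq]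
    linear_combination β (π x) * unit_mul_conj (hφ x)
  · rw [Matrix.diagonal_apply_ne _ hxy, Matrix.diagonal_apply_ne, mul_zero, zero_mul]
    exact fun h => hxy (by rw [← hπ x, h, hπ])

/-- An exact controlled phase: the product of the phases attached to `a`, to `s` and to the sum of
the two bits. -/
lemma exists_controlled_phase_circuit (a s : Fin n) (has : a ≠ s) (b : Fin 2) {ζ : ℂ}
    (hζ : ‖ζ‖ = 1) :
    ∃ c : Circuit n, c.cnotCount = 2 ∧
      c.toMatrix = Matrix.diagonal fun x : Bits n => if x a = 1 ∧ x s = b then ζ else 1 := by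
  obtain ⟨η, hη, hηn⟩ := exists_unit_sq_eq hζ
  have hηc := unit_mul_conj hηn
  have h1 : ∀ i : Fin 2, ‖(if i = 1 then η else 1 : ℂ)‖ = 1 := by
    intro i; split_ifs <;> simp [hηn]
  have h2 : ∀ i : Fin 2, ‖(if i = b then η else 1 : ℂ)‖ = 1 := by
    intro i; split_ifs <;> simp [hηn]
  have h3 : ∀ i : Fin 2, ‖(if i = b then (starRingEnd ℂ) η else 1 : ℂ)‖ = 1 := by
    intro i; split_ifs <;> simp [hηn]
  set X : Circuit n := [.cnot a s has] with hX
  have hXM : ∀ x y, X.toMatrix x y =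
      if x = (fun y : Bits n => Function.update y s (y s + y a)) y then (fun _ => (1 : ℂ)) y
        else 0 := by
    intro x y
    simp [hX, Circuit.toMatrix, Gate.toMatrix]
  have hinv : ∀ y : Bits n, (fun y : Bits n => Function.update y s (y s + y a))
      ((fun y : Bits n => Function.update y s (y s + y a)) y) = y := by
    intro y
    simp [Function.update_of_ne has, add_assoc, fin_two_add_self]
  have hpar := conj_perm_diagonal
    (d := [.single s ⟨_, diagonal_mem_unitaryGroup h3⟩])
    hXM hinv (fun _ => by simp) (β := fun x => if x s = b then (starRingEnd ℂ) η else 1) (by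
      rw [Circuit.toMatrix, Circuit.toMatrix, Matrix.one_mul, single_diagonal_toMatrix s _ h3])
  refine ⟨[.single a ⟨_, diagonal_mem_unitaryGroup h1⟩, .single s ⟨_, diagonal_mem_unitaryGroup h2⟩]
    ++ (X ++ ([.single s ⟨_, diagonal_mem_unitaryGroup h3⟩] ++ Circuit.inv X)), rfl, ?_⟩
  rw [toMatrix_append, hpar]
  simp only [Circuit.toMatrix, Matrix.one_mul]
  rw [single_diagonal_toMatrix a _ h1, single_diagonal_toMatrix s _ h2,
    Matrix.diagonal_mul_diagonal, Matrix.diagonal_mul_diagonal]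
  congr 1; funext x
  simp only [Function.update_self]
  rcases fin_two_cases (x a) with h | h <;> rcases fin_two_cases (x s) with h' | h' <;>
    rcases fin_two_cases b with hb | hb <;> simp [h, h', hb, ← hη] <;>
    first
    | linear_combination hηc
    | ring

/-- A phase at a single basis vector with clean ancilla, exact on the subspace where the ancilla is
clean. -/
lemma exists_phase_circuit (a s : Fin n) (has : a ≠ s) (k : Bits n) (hk : k a = 0) {ζ : ℂ}
    (hζ : ‖ζ‖ = 1) :
    ∃ c : Circuit n, c.cnotCount ≤ 48 * n + 50 ∧ ∀ x y : Bits n, y a = 0 →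
      c.toMatrix x y = if x = y then (if y = k then ζ else 1) else 0 := by
  obtain ⟨A, φ, hA, hφ, hAM⟩ := exists_indicator_circuit a s has k
  obtain ⟨B, hB, hBM⟩ := exists_controlled_phase_circuit a s has (k s) hζ
  refine ⟨A ++ (B ++ Circuit.inv A), ?_, fun x y hy => ?_⟩
  · rw [cnotCount_append, cnotCount_append, Circuit.cnotCount_inv]; omega
  · have hinv := flipIf_involutive (t := a) (P := fun y => ∀ p, p ≠ a → p ≠ s → y p = k p)
      (fun y b => forall_congr' fun p => forall_congr' fun hp => by rw [Function.update_of_ne hp])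
    rw [conj_perm_diagonal hAM hinv hφ hBM, Matrix.diagonal_apply]
    by_cases hxy : x = y
    · subst hxy
      rw [if_pos rfl, if_pos rfl, flipIf_off_apply_ne has.symm, flipIf, Function.update_self, hy,
        zero_add]
      congr 1
      rw [eq_iff_iff]
      constructor
      · rintro ⟨h1, h2⟩
        have hP : ∀ p, p ≠ a → p ≠ s → x p = k p := by
          by_contra h
          rw [indicatorBit_of_false h] at h1
          exact absurd h1 (by decide)
        funext p
        by_cases hpa : p = a
        · rw [hpa, hy, hk]
        · by_cases hps : p = s
          · rw [hps, h2]
          · exact hP p hpa hps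
      · rintro rfl
        exact ⟨indicatorBit_of_true fun _ _ _ => rfl, rfl⟩
    · rw [if_neg hxy, if_neg hxy]

lemma exists_phases_circuit (a s : Fin n) (has : a ≠ s) {K : ℕ} (e : Fin K → Bits n)
    (he : ∀ i, e i a = 0) (ζ : Fin K → ℂ) (hζ : ∀ i, ‖ζ i‖ = 1) (T : Finset (Fin K)) :
    ∃ c : Circuit n, c.cnotCount ≤ T.card * (48 * n + 50) ∧ ∀ x y : Bits n, y a = 0 →
      c.toMatrix x y = if x = y then (∏ i ∈ T, if y = e i then ζ i else 1) else 0 := by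
  induction T using Finset.induction with
  | empty =>
    exact ⟨[], by simp [Circuit.cnotCount], fun x y _ => by
      simp [Circuit.toMatrix, Matrix.one_apply]⟩
  | insert i T hi ih =>
    obtain ⟨c, hc, hM⟩ := ih
    obtain ⟨d, hd, hN⟩ := exists_phase_circuit a s has (e i) (he i) (hζ i)
    refine ⟨c ++ d, ?_, fun x y hy => ?_⟩
    · rw [cnotCount_append, Finset.card_insert_of_notMem hi, Nat.succ_mul]; omega
    · rw [toMatrix_append, Matrix.mul_apply, Finset.sum_eq_single y
        (fun z _ hz => by rw [hM z y hy, if_neg hz, mul_zero]) (by simp), hM y y hy, if_pos rfl,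
        hN x y hy, Finset.prod_insert hi]
      split_ifs <;> simp

end Register

/-! ### Singular value decomposition -/

lemma norm_sq_toLp {ι : Type*} [Fintype ι] (v : ι → ℂ) :
    ((‖(WithLp.toLp 2 v : EuclideanSpace ℂ ι)‖ ^ 2 : ℝ) : ℂ) = star v ⬝ᵥ v := by
  rw [EuclideanSpace.norm_sq_eq, dotProduct]
  push_cast
  refine Finset.sum_congr rfl fun i _ => ?_
  rw [Pi.star_apply, mul_comm]
  exact (Complex.mul_conj' _).symm

section SingularValues

variable {ι : Type*} [Fintype ι] [DecidableEq ι]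

lemma specNorm_zero : specNorm (0 : Matrix ι ι ℂ) = 0 := by
  rw [specNorm, map_zero, norm_zero]

lemma specNorm_pos {A : Matrix ι ι ℂ} (hA : A ≠ 0) : 0 < specNorm A := by
  rw [specNorm, norm_pos_iff]
  exact fun h => hA ((EmbeddingLike.map_eq_zero_iff (f := Matrix.toEuclideanCLM (𝕜 := ℂ))).1 h)

/-- The singular value decomposition of a matrix of rank `K`. -/
theorem exists_singular_value_decomposition (A : Matrix ι ι ℂ) :
    ∃ (v w : Fin A.rank → ι → ℂ) (σ : Fin A.rank → ℝ),
      (∀ i j, star (v i) ⬝ᵥ v j = if i = j then 1 else 0) ∧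
      (∀ i j, star (w i) ⬝ᵥ w j = if i = j then 1 else 0) ∧
      (∀ i, 0 ≤ σ i) ∧ (∀ i, σ i ≤ specNorm A) ∧
      ∀ x y, A x y = ∑ i, (σ i : ℂ) * w i x * (starRingEnd ℂ) (v i y) := by
  have hA := isHermitian_conjTranspose_mul_self A
  set U : Matrix ι ι ℂ := (hA.eigenvectorUnitary : Matrix ι ι ℂ) with hU
  have hUU : Uᴴ * U = 1 := by
    rw [← Matrix.star_eq_conjTranspose]; exact Matrix.UnitaryGroup.star_mul_self _
  have hUU' : U * Uᴴ = 1 := mul_eq_one_comm.1 hUU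
  set W := A * U with hW
  set lam := hA.eigenvalues with hlam
  have hWW : Wᴴ * W = Matrix.diagonal fun i => (lam i : ℂ) := by
    have h1 : (Aᴴ * A) * U = U * Matrix.diagonal fun i => (lam i : ℂ) := by
      have h := hA.spectral_theorem
      rw [Unitary.conjStarAlgAut_apply] at h
      conv_lhs => rw [h]
      rw [Matrix.mul_assoc, Matrix.star_eq_conjTranspose]
      erw [hUU, Matrix.mul_one]
      rfl
    rw [hW, Matrix.conjTranspose_mul, Matrix.mul_assoc, ← Matrix.mul_assoc Aᴴ, h1,
      ← Matrix.mul_assoc, hUU, Matrix.one_mul]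
  have hUcol : ∀ i j, star (fun x => U x i) ⬝ᵥ (fun x => U x j) = if i = j then 1 else 0 := by
    intro i j
    have := congrFun (congrFun hUU i) j
    rwa [Matrix.one_apply] at this
  have hWcol : ∀ i j, star (fun x => W x i) ⬝ᵥ (fun x => W x j) =
      if i = j then (lam i : ℂ) else 0 := by
    intro i j
    have := congrFun (congrFun hWW i) j
    rwa [Matrix.diagonal_apply] at this
  have hWnorm : ∀ i, ‖(WithLp.toLp 2 (fun x => W x i) : EuclideanSpace ℂ ι)‖ ^ 2 = lam i := by
    intro i
    have := norm_sq_toLp (fun x => W x i)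
    rw [hWcol, if_pos rfl] at this
    exact_mod_cast this
  have hUnorm : ∀ i, ‖(WithLp.toLp 2 (fun x => U x i) : EuclideanSpace ℂ ι)‖ = 1 := by
    intro i
    have := norm_sq_toLp (fun x => U x i)
    rw [hUcol, if_pos rfl] at this
    have h2 : ‖(WithLp.toLp 2 (fun x => U x i) : EuclideanSpace ℂ ι)‖ ^ 2 = 1 := by
      exact_mod_cast this
    exact (pow_eq_one_iff_of_nonneg (norm_nonneg _) (by norm_num)).1 h2
  have hlam0 : ∀ i, 0 ≤ lam i := fun i => by rw [← hWnorm i]; positivity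
  have hsq : ∀ i, Real.sqrt (lam i) ≤ specNorm A := by
    intro i
    rw [← hWnorm i, Real.sqrt_sq (norm_nonneg _)]
    have h1 := (Matrix.toEuclideanCLM (𝕜 := ℂ) A).le_opNorm
      (WithLp.toLp 2 fun x => U x i : EuclideanSpace ℂ ι)
    rw [hUnorm, mul_one, Matrix.toEuclideanCLM_toLp] at h1
    exact h1
  have hcard : Fintype.card {i // lam i ≠ 0} = A.rank := by
    rw [← hA.rank_eq_card_non_zero_eigs]
    open scoped ComplexOrder in exact Matrix.rank_conjTranspose_mul_self A
  let f : Fin A.rank ≃ {i // lam i ≠ 0} := (Fintype.equivFinOfCardEq hcard).symm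
  have hf : ∀ i, (Real.sqrt (lam (f i)) : ℂ) ≠ 0 := fun i => by
    have : 0 < lam (f i) := lt_of_le_of_ne (hlam0 _) (f i).2.symm
    exact_mod_cast (Real.sqrt_pos.2 this).ne'
  have hinj : ∀ i j, ((f i : ι) = f j) ↔ i = j := fun i j => by
    rw [← Subtype.ext_iff, f.injective.eq_iff]
  refine ⟨fun i x => U x (f i), fun i x => (Real.sqrt (lam (f i)) : ℂ)⁻¹ * W x (f i),
    fun i => Real.sqrt (lam (f i)), ?_, ?_, fun i => Real.sqrt_nonneg _, fun i => hsq _, ?_⟩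
  · intro i j
    rw [hUcol]
    simp only [hinj]
  · intro i j
    have hs : ∀ i, (fun x => (Real.sqrt (lam (f i)) : ℂ)⁻¹ * W x (f i)) =
        (Real.sqrt (lam (f i)) : ℂ)⁻¹ • fun x => W x (f i) := fun i => rfl
    beta_reduce
    rw [hs, hs, star_smul, smul_dotProduct, dotProduct_smul, hWcol]
    simp only [hinj]
    split_ifs with hij
    · subst hij
      have h1 : star ((Real.sqrt (lam (f i)) : ℂ)⁻¹) = (Real.sqrt (lam (f i)) : ℂ)⁻¹ := by
        rw [star_inv₀]; congr 1; exact Complex.conj_ofReal _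
      have h2 : (lam (f i) : ℂ) = (Real.sqrt (lam (f i)) : ℂ) * (Real.sqrt (lam (f i)) : ℂ) := by
        rw [← Complex.ofReal_mul, Real.mul_self_sqrt (hlam0 _)]
      rw [h1, smul_eq_mul, smul_eq_mul, h2]
      have := hf i
      field_simp
    · simp
  · intro x y
    have h1 : A = W * Uᴴ := by rw [hW, Matrix.mul_assoc, hUU', Matrix.mul_one]
    conv_lhs => rw [h1]
    rw [Matrix.mul_apply]
    symm
    refine Finset.sum_of_injOn (fun i => (f i : ι)) (fun i _ j _ h => (hinj i j).1 h)
      (fun _ _ => Finset.mem_coe.2 (Finset.mem_univ _)) ?_ ?_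
    · intro i _ hi
      have hi0 : lam i = 0 := by
        by_contra h
        exact hi ⟨f.symm ⟨i, h⟩, by simp, by simp⟩
      have h2 := hWnorm i
      rw [hi0, pow_eq_zero_iff two_ne_zero, norm_eq_zero] at h2
      have h3 : W x i = 0 := congrFun (congrArg WithLp.ofLp h2) x
      rw [h3, zero_mul]
    · intro i _
      have := hf i
      rw [Matrix.conjTranspose_apply, mul_inv_cancel_left₀ this]
      rfl

end SingularValues

/-! ### The block-encoding circuit -/

section Assembly

variable {m : ℕ}

/-- The basis vector `|0⟩ ⊗ |i⟩`. -/
def ancillaIndex (m : ℕ) (i : Fin (2 ^ m)) : Bits (1 + m) :=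
  Fin.append (0 : Bits 1) (binary m i)

lemma ancillaBlock_apply (U : Matrix (Bits (1 + m)) (Bits (1 + m)) ℂ) (i j : Fin (2 ^ m)) :
    ancillaBlock 1 m U i j = U (ancillaIndex m i) (ancillaIndex m j) := rfl

/-- The ancilla qubit. -/
def ancilla (m : ℕ) : Fin (1 + m) := Fin.castAdd m 0

lemma ancillaIndex_ancilla (i : Fin (2 ^ m)) : ancillaIndex m i (ancilla m) = 0 := by
  rw [ancillaIndex, ancilla, Fin.append_left]; rfl

lemma ancillaIndex_injective : Function.Injective (ancillaIndex m) := by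
  intro i j h
  refine (binary m).injective (funext fun p => ?_)
  have := congrFun h (Fin.natAdd 1 p)
  rwa [ancillaIndex, ancillaIndex, Fin.append_right, Fin.append_right] at this

lemma exists_ancillaIndex {y : Bits (1 + m)} (hy : y (ancilla m) = 0) :
    ∃ i, ancillaIndex m i = y := by
  refine ⟨(binary m).symm fun p => y (Fin.natAdd 1 p), funext fun p => ?_⟩
  rw [ancillaIndex, Equiv.apply_symm_apply]
  refine Fin.addCases (fun q => ?_) (fun q => ?_) p
  · rw [Fin.append_left, Subsingleton.elim q 0]
    exact hy.symm
  · rw [Fin.append_right]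

lemma sum_ancillaIndex {f : Bits (1 + m) → ℂ} (hf : ∀ y, y (ancilla m) ≠ 0 → f y = 0) :
    ∑ y, f y = ∑ i, f (ancillaIndex m i) := by
  symm
  refine Finset.sum_of_injOn (ancillaIndex m) ancillaIndex_injective.injOn
    (fun _ _ => Finset.mem_coe.2 (Finset.mem_univ _)) ?_ (fun _ _ => rfl)
  intro y _ hy
  refine hf y fun h => hy ?_
  obtain ⟨i, hi⟩ := exists_ancillaIndex h
  exact ⟨i, by simp, hi⟩

/-- The vector `|0⟩ ⊗ w`. -/
def ancillaVec (w : Fin (2 ^ m) → ℂ) (y : Bits (1 + m)) : ℂ :=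
  if y (ancilla m) = 0 then w ((binary m).symm fun p => y (Fin.natAdd 1 p)) else 0

lemma ancillaVec_ancillaIndex (w : Fin (2 ^ m) → ℂ) (i : Fin (2 ^ m)) :
    ancillaVec w (ancillaIndex m i) = w i := by
  rw [ancillaVec, if_pos (ancillaIndex_ancilla i)]
  congr 1
  rw [Equiv.symm_apply_eq]
  funext p
  rw [ancillaIndex, Fin.append_right]

lemma ancillaVec_eq_zero (w : Fin (2 ^ m) → ℂ) (y : Bits (1 + m)) (h : y (ancilla m) ≠ 0) :
    ancillaVec w y = 0 := if_neg h

lemma star_ancillaVec_dotProduct (v w : Fin (2 ^ m) → ℂ) :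
    star (ancillaVec v) ⬝ᵥ ancillaVec w = star v ⬝ᵥ w := by
  rw [dotProduct, sum_ancillaIndex, dotProduct]
  · simp only [Pi.star_apply, ancillaVec_ancillaIndex]
  · intro y hy; rw [ancillaVec_eq_zero w y hy, mul_zero]

/-- The first `K` basis vectors with clean ancilla in lexicographic order. -/
lemma exists_lex_enumeration {K : ℕ} (hK : K ≤ 2 ^ m) :
    ∃ e : Fin K → Bits (1 + m), (∀ i, e i (ancilla m) = 0) ∧
      (∀ i y, y (ancilla m) = 0 → toLex y < toLex (e i) → ∃ i' < i, y = e i') ∧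
      ∀ i i', i < i' → toLex (e i) < toLex (e i') := by
  classical
  let S : Finset (Lex (Bits (1 + m))) := Finset.univ.image fun i => toLex (ancillaIndex m i)
  have hS : S.card = 2 ^ m := by
    refine (Finset.card_image_of_injective _
      (toLex.injective.comp ancillaIndex_injective)).trans ?_
    rw [Finset.card_univ, Fintype.card_fin]
  let g := S.orderEmbOfFin hS
  have hmem : ∀ i, g i ∈ S := fun i => S.orderEmbOfFin_mem hS i
  refine ⟨fun i => ofLex (g (Fin.castLE hK i)), fun i => ?_, fun i y hy hlt => ?_,
    fun i i' h => g.strictMono h⟩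
  · obtain ⟨j, -, hj⟩ := Finset.mem_image.1 (hmem (Fin.castLE hK i))
    beta_reduce
    rw [← hj, ofLex_toLex]
    exact ancillaIndex_ancilla j
  · obtain ⟨l, hl⟩ := exists_ancillaIndex hy
    have hyS : toLex y ∈ Set.range g := by
      rw [Finset.range_orderEmbOfFin]
      exact Finset.mem_coe.2 (Finset.mem_image.2 ⟨l, Finset.mem_univ _, by rw [hl]⟩)
    obtain ⟨j, hj⟩ := hyS
    rw [← hj] at hlt
    have hji : j < Fin.castLE hK i := g.lt_iff_lt.1 hlt
    have hjK : (j : ℕ) < K := lt_trans hji i.2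
    exact ⟨⟨j, hjK⟩, hji, congrArg ofLex hj.symm⟩

/-- A real rotation with prescribed upper left entry. -/
lemma exists_unitary_apply_zero_zero {t : ℝ} (h0 : 0 ≤ t) (h1 : t ≤ 1) :
    (!![(t : ℂ), -(Real.sqrt (1 - t ^ 2) : ℂ); (Real.sqrt (1 - t ^ 2) : ℂ), t] :
      Matrix (Fin 2) (Fin 2) ℂ) ∈ Matrix.unitaryGroup (Fin 2) ℂ := by
  have h2 : (Real.sqrt (1 - t ^ 2) : ℂ) * (Real.sqrt (1 - t ^ 2) : ℂ) = 1 - t ^ 2 := by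
    rw [← Complex.ofReal_mul, Real.mul_self_sqrt (by nlinarith)]
    push_cast; ring
  rw [Matrix.mem_unitaryGroup_iff]
  ext i j
  fin_cases i <;> fin_cases j <;>
    simp [Matrix.mul_apply, Fin.sum_univ_two, Matrix.star_apply] <;>
    first
    | linear_combination h2
    | ring

/-- The multiplexed rotation of the ancilla that has prescribed upper left entries at finitely many
basis vectors of the system, and `0` at the others, up to phases. -/
lemma exists_ancilla_mux_circuit {K : ℕ} (e : Fin K → Bits (1 + m))
    (hinj : Function.Injective e) (τ : Fin K → ℝ)
    (h0 : ∀ i, 0 ≤ τ i) (h1 : ∀ i, τ i ≤ 1) :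
    ∃ (c : Circuit (1 + m)) (D : Bits (1 + m) → ℂ), c.cnotCount ≤ 2 ^ m ∧ (∀ x, ‖D x‖ = 1) ∧
      ∀ x y : Bits (1 + m), x (ancilla m) = 0 → y (ancilla m) = 0 →
        c.toMatrix x y = if x = y then D x * ∑ i, (if x = e i then (τ i : ℂ) else 0) else 0 := by
  classical
  set a := ancilla m with ha
  let t : Bits (1 + m) → ℝ := fun x => ∑ i, if Function.update x a 0 = e i then τ i else 0
  have ht : ∀ x, 0 ≤ t x ∧ t x ≤ 1 := by
    intro x
    by_cases hx : ∃ i, Function.update x a 0 = e i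
    · obtain ⟨i, hi⟩ := hx
      have : t x = τ i := by
        simp only [t]
        rw [Finset.sum_eq_single i (fun j _ hj => if_neg fun h => hj (hinj (h.symm.trans hi)))
          (by simp), if_pos hi]
      rw [this]; exact ⟨h0 i, h1 i⟩
    · have : t x = 0 := Finset.sum_eq_zero fun i _ => if_neg fun h => hx ⟨i, h⟩
      rw [this]; exact ⟨le_rfl, zero_le_one⟩
  obtain ⟨c, D, hc, hD, -, hM⟩ := exists_mux_circuit a (Finset.univ.erase a) (by simp)
    (fun x => !![(t x : ℂ), -(Real.sqrt (1 - t x ^ 2) : ℂ); (Real.sqrt (1 - t x ^ 2) : ℂ), t x])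
    (fun x => exists_unitary_apply_zero_zero (ht x).1 (ht x).2)
    (fun x y h => by
      have : Function.update x a 0 = Function.update y a 0 := by
        funext p
        by_cases hp : p = a
        · subst hp; simp
        · rw [Function.update_of_ne hp, Function.update_of_ne hp, h p (by simp [hp])]
      simp only [t, this])
  refine ⟨c, D, ?_, hD, fun x y hx hy => ?_⟩
  · rw [Finset.card_erase_of_mem (Finset.mem_univ _), Finset.card_univ, Fintype.card_fin,
      Nat.add_sub_cancel_left] at hc
    omega
  · rw [hM, Matrix.diagonal_mul, mux, Matrix.of_apply]
    by_cases hxy : x = y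
    · subst hxy
      rw [if_pos (fun _ _ => rfl), if_pos rfl, hx]
      have : Function.update x a 0 = x := by rw [← hx, Function.update_eq_self]
      simp [t, this, apply_ite]
    · rw [if_neg hxy, if_neg, mul_zero]
      intro h
      refine hxy (funext fun p => ?_)
      by_cases hp : p = a
      · rw [hp, hx, hy]
      · exact h p hp

lemma conj_apply_of_mulVec_eq_single {n : ℕ} {c : Circuit n} {v : Bits n → ℂ} {k : Bits n} {φ : ℂ}
    (h : c.toMatrix *ᵥ v = Pi.single k φ) (hφ : ‖φ‖ = 1) (y : Bits n) :
    c.toMatrix k y = (starRingEnd ℂ) (v y) * φ := by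
  have h1 : v = c.toMatrixᴴ *ᵥ Pi.single k φ := by
    rw [← h, Matrix.mulVec_mulVec, Circuit.conjTranspose_mul_self, Matrix.one_mulVec]
  have h2 : v y = (starRingEnd ℂ) (c.toMatrix k y) * φ := by
    conv_lhs => rw [h1]
    simp [Matrix.mulVec_single, Matrix.conjTranspose_apply, mul_comm]
  rw [h2, map_mul, Complex.conj_conj]
  linear_combination -(c.toMatrix k y) * unit_mul_conj hφ

/-- Block-encoding of a matrix given by its singular value decomposition: two isometries, a phase
correction and a multiplexed rotation of the ancilla. -/
theorem exists_block_encoding_circuit (hm : 1 ≤ m) {K : ℕ} (hK : K ≤ 2 ^ m)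
    (v w : Fin K → Fin (2 ^ m) → ℂ)
    (hv : ∀ i j, star (v i) ⬝ᵥ v j = if i = j then 1 else 0)
    (hw : ∀ i j, star (w i) ⬝ᵥ w j = if i = j then 1 else 0)
    (τ : Fin K → ℝ) (h0 : ∀ i, 0 ≤ τ i) (h1 : ∀ i, τ i ≤ 1) :
    ∃ c : Circuit (1 + m), c.cnotCount ≤
        2 * (K * (2 ^ m + (1 + m) * (48 * (1 + m) + 49))) + K * (48 * (1 + m) + 50) + 2 ^ m ∧
      ∀ x y, ancillaBlock 1 m c.toMatrix x y =
        ∑ i, (τ i : ℂ) * w i x * (starRingEnd ℂ) (v i y) := by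
  classical
  obtain ⟨e, hea, he, he'⟩ := exists_lex_enumeration hK
  have hinj : Function.Injective e := by
    intro i j hij
    rcases lt_trichotomy i j with h | h | h
    · exact absurd (he' i j h) (by rw [hij]; exact lt_irrefl _)
    · exact h
    · exact absurd (he' j i h) (by rw [hij]; exact lt_irrefl _)
  have ha0 : ((ancilla m : Fin (1 + m)) : ℕ) = 0 := rfl
  have hvec : ∀ (u : Fin K → Fin (2 ^ m) → ℂ) i y, ancillaVec (u i) y ≠ 0 → y (ancilla m) = 0 := by
    intro u i y h
    by_contra h'
    exact h (ancillaVec_eq_zero _ y h')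
  obtain ⟨V, φ, hVc, hVp, hφ, hV⟩ := exists_isometry_circuit (ancilla m) ha0 e hea he he'
    (fun i => ancillaVec (v i)) (hvec v) (fun i j => by rw [star_ancillaVec_dotProduct, hv])
  obtain ⟨W, ψ, hWc, hWp, hψ, hW⟩ := exists_isometry_circuit (ancilla m) ha0 e hea he he'
    (fun i => ancillaVec (w i)) (hvec w) (fun i j => by rw [star_ancillaVec_dotProduct, hw])
  obtain ⟨R, D, hRc, hD, hR⟩ := exists_ancilla_mux_circuit e hinj τ h0 h1
  obtain ⟨P, hPc, hP⟩ := exists_phases_circuit (ancilla m) (Fin.natAdd 1 ⟨0, hm⟩)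
    (by intro h; have := congrArg Fin.val h; simp [ancilla] at this) e hea
    -- The phase at `e i` undoes those of `V`, of the rotation of the ancilla and of `W⁻¹`.
    (fun i => ψ i * (starRingEnd ℂ) (D (e i)) * (starRingEnd ℂ) (φ i))
    (fun i => by simp [hφ, hψ, hD]) Finset.univ
  set θ : Bits (1 + m) → ℂ := fun y => ∏ i, if y = e i then
    ψ i * (starRingEnd ℂ) (D (e i)) * (starRingEnd ℂ) (φ i) else 1 with hθ
  have hθe : ∀ i, θ (e i) = ψ i * (starRingEnd ℂ) (D (e i)) * (starRingEnd ℂ) (φ i) := by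
    intro i
    simp only [hθ]
    rw [Finset.prod_eq_single i (fun j _ hj => if_neg fun h => hj (hinj h).symm) (by simp),
      if_pos rfl]
  have hτe : ∀ k, (∑ i, if e k = e i then (τ i : ℂ) else 0) = τ k := by
    intro k
    rw [Finset.sum_eq_single k (fun j _ hj => if_neg fun h => hj (hinj h).symm) (by simp),
      if_pos rfl]
  refine ⟨V ++ (P ++ (R ++ Circuit.inv W)), ?_, fun x y => ?_⟩
  · simp only [cnotCount_append, Circuit.cnotCount_inv]
    rw [Finset.card_univ, Fintype.card_fin] at hPc
    rw [Nat.add_sub_cancel_left] at hVc hWc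
    omega
  · rw [ancillaBlock_apply]
    simp only [toMatrix_append, Circuit.toMatrix_inv]
    rw [Matrix.mul_assoc, Matrix.mul_apply]
    have hxa := ancillaIndex_ancilla (m := m) x
    have hya := ancillaIndex_ancilla (m := m) y
    have hPV : ∀ z, (P.toMatrix * V.toMatrix) z (ancillaIndex m y) =
        θ z * V.toMatrix z (ancillaIndex m y) := by
      intro z
      rw [Matrix.mul_apply, Finset.sum_eq_single z ?_ (by simp)]
      · by_cases hz : z (ancilla m) = 0
        · rw [hP z z hz, if_pos rfl]
        · rw [hVp z _ (by rw [hya]; exact hz), mul_zero, mul_zero]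
      · intro z' _ hz'
        by_cases hz : z' (ancilla m) = 0
        · rw [hP z z' hz, if_neg hz'.symm, zero_mul]
        · rw [hVp z' _ (by rw [hya]; exact hz), mul_zero]
    have hWR : ∀ z : Bits (1 + m), z (ancilla m) = 0 →
        (W.toMatrixᴴ * R.toMatrix) (ancillaIndex m x) z =
          (starRingEnd ℂ) (W.toMatrix z (ancillaIndex m x)) *
            (D z * ∑ i, if z = e i then (τ i : ℂ) else 0) := by
      intro z hz
      rw [Matrix.mul_apply, Finset.sum_eq_single z ?_ (by simp)]
      · rw [hR z z hz hz, if_pos rfl]; rfl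
      · intro z' _ hz'
        by_cases hz0 : z' (ancilla m) = 0
        · rw [hR z' z hz0 hz, if_neg hz', mul_zero]
        · rw [Matrix.conjTranspose_apply, hWp z' _ (by rw [hxa]; exact hz0), star_zero, zero_mul]
    symm
    rw [← Matrix.mul_apply, ← Matrix.mul_assoc, Matrix.mul_assoc (W.toMatrixᴴ * R.toMatrix),
      Matrix.mul_apply]
    refine Finset.sum_of_injOn e hinj.injOn (fun _ _ => Finset.mem_coe.2 (Finset.mem_univ _))
      ?_ ?_
    · intro z _ hz
      by_cases hz0 : z (ancilla m) = 0
      · rw [hWR z hz0, Finset.sum_eq_zero fun i _ => if_neg fun h => hz ⟨i, by simp, h.symm⟩,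
          mul_zero, mul_zero, zero_mul]
      · rw [hPV, hVp z _ (by rw [hya]; exact hz0), mul_zero, mul_zero]
    · intro k _
      rw [hWR _ (hea k), hPV, hθe, hτe, conj_apply_of_mulVec_eq_single (hV k) (hφ k),
        conj_apply_of_mulVec_eq_single (hW k) (hψ k), ancillaVec_ancillaIndex,
        ancillaVec_ancillaIndex, map_mul, Complex.conj_conj]
      have e1 := unit_mul_conj (hφ k)
      have e2 := unit_mul_conj (hψ k)
      have e3 := unit_mul_conj (hD (e k))
      have e4 : (ψ k * (starRingEnd ℂ) (ψ k)) * (D (e k) * (starRingEnd ℂ) (D (e k))) *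
          (φ k * (starRingEnd ℂ) (φ k)) = 1 := by rw [e1, e2, e3]; norm_num
      linear_combination -((τ k : ℂ) * w k x * (starRingEnd ℂ) (v k y)) * e4

lemma cnotCount_bound (K m : ℕ) :
    ((2 * (K * (2 ^ m + (1 + m) * (48 * (1 + m) + 49))) + K * (48 * (1 + m) + 50) + 2 ^ m : ℕ) : ℝ)
      ≤ ((K : ℝ) + 11 / 12) * 2 ^ (m + 1) + 292 * ((K : ℝ) * ((m + 1 : ℕ) : ℝ) ^ 2) := by
  push_cast
  have hm : (0 : ℝ) ≤ m := Nat.cast_nonneg m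
  have hp : (0 : ℝ) ≤ 2 ^ m := by positivity
  have hK : (0 : ℝ) ≤ K := Nat.cast_nonneg K
  have key : 2 * ((1 + (m : ℝ)) * (48 * (1 + m) + 49)) + (48 * (1 + m) + 50) ≤
      292 * ((m : ℝ) + 1) ^ 2 := by nlinarith
  have := mul_le_mul_of_nonneg_left key hK
  rw [pow_succ]
  linarith

end Assembly

end QuantumCircuit

theorem mainTheorem3 :
    ∃ C : ℝ, 0 < C ∧
      ∀ (n K : ℕ) (A : Matrix (Fin (2 ^ (n - 1))) (Fin (2 ^ (n - 1))) ℂ),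
        1 ≤ n → A.rank = K → 1 ≤ K → K ≤ 2 ^ (n - 1) - 1 →
          ∃ c : QuantumCircuit.Circuit (1 + (n - 1)),
            QuantumCircuit.IsBlockEncoding (QuantumCircuit.specNorm A) 1
              (QuantumCircuit.Circuit.toMatrix c) A ∧
            (QuantumCircuit.Circuit.cnotCount c : ℝ) ≤
              ((K : ℝ) + 11 / 12) * 2 ^ n + C * ((K : ℝ) * (n : ℝ) ^ 2) := by
  -- `292` bounds the coefficient of `K n ^ 2`: two columns at `97` and one phase gate at `98`.
  refine ⟨292, by norm_num, fun n K A hn hrank hK1 hK => ?_⟩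
  subst hrank
  -- A second qubit is needed as a borrowed bit; for `n = 1` the range of `K` is empty.
  have hm : 1 ≤ n - 1 := by
    by_contra h
    have h0 : n - 1 = 0 := by omega
    have h1 : 2 ^ (n - 1) = 1 := by rw [h0, pow_zero]
    omega
  have hA : A ≠ 0 := by
    rintro rfl
    rw [Matrix.rank_zero] at hK1
    omega
  have hpos := QuantumCircuit.specNorm_pos hA
  set α := QuantumCircuit.specNorm A with hα
  have hαC : (α : ℂ) ≠ 0 := by exact_mod_cast hpos.ne'
  obtain ⟨v, w, σ, hv, hw, hσ0, hσ1, hsvd⟩ :=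
    QuantumCircuit.exists_singular_value_decomposition A
  obtain ⟨c, hc, hblock⟩ := QuantumCircuit.exists_block_encoding_circuit hm (by omega) v w hv hw
    (fun i => σ i / α) (fun i => div_nonneg (hσ0 i) hpos.le)
    (fun i => (div_le_one hpos).2 (hσ1 i))
  refine ⟨c, ⟨hpos, QuantumCircuit.Circuit.toMatrix_mem_unitaryGroup c, ?_⟩, ?_⟩
  · have h : A - (α : ℂ) • QuantumCircuit.ancillaBlock 1 (n - 1)
        (QuantumCircuit.Circuit.toMatrix c) = 0 := by
      ext x y
      rw [Matrix.sub_apply, Matrix.smul_apply, hblock, hsvd x y, smul_eq_mul, Finset.mul_sum,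
        ← Finset.sum_sub_distrib, Matrix.zero_apply]
      refine Finset.sum_eq_zero fun i _ => ?_
      push_cast
      field_simp
      ring
    rw [h, QuantumCircuit.specNorm_zero]
  · have h := QuantumCircuit.cnotCount_bound A.rank (n - 1)
    rw [Nat.sub_add_cancel hn] at h
    exact ((Nat.cast_le (α := ℝ)).2 hc).trans h
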